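/- Let $\lambda>0$ and let $G$ be a probability distribution on $[0,\infty)$. Customers arrive at times $T_n=I_1+\dots+I_n$ ($T_0=0$), where the $I_n$ are exponential with mean $1/\lambda$; the $n$-th customer has service requirement $S_n$ with law $G$, and all $I_n$ and $S_n$, $n\ge 1$, are independent. For $x\ge 0$ let $V_t^x$ be the workload process of the queue with bounded waiting time: $V_0^x=x$, $V_t^x=\max[V_{T_{n-1}}^x-(t-T_{n-1}),0]$ for $T_{n-1}\le t<T_n$, and $V_{T_n}^x=V_{T_n-}^x+S_n\mathbf 1_{\{V_{T_n-}^x<1\}}$, where $V_{T_n-}^x$ is the workload immediately before time $T_n$. A probability measure $\pi$ on $[0,\infty)$ is an invariant distribution if $\int \mathbb P(V_t^x\in A)\,\pi(dx)=\pi(A)$ for all $t\ge 0$ and all Borel sets $A$. Let $\bar G(x)=G((x,\infty))$, $\bar G^{*1}=\bar G$ and $\bar G^{*(i+1)}(x)=\int_0^x\bar G(x-y)\,\bar G^{*i}(y)\,dy$ for $x>0$. If $\mathbb E(S_1)<\infty$, then the process has an invariant distribution, and the restriction of any invariant distribution to $(0,\infty)$ has the Lebesgue density $$\tilde\pi(x)=\begin{cases}\dfrac{\sum_{i=1}^\infty\lambda^i\bar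 G^{*i}(x)}{1+\lambda\mathbb E(S_1)\bigl(1+\sum_{i=1}^\infty\lambda^i\int_0^1\bar G^{*i}(y)\,dy\bigr)}, & x\in(0,1],\\[3ex] \dfrac{\lambda\bar G(x)+\lambda\sum_{i=1}^\infty\lambda^i\int_0^1\bar G(x-y)\,\bar G^{*i}(y)\,dy}{1+\lambda\mathbb E(S_1)\bigl(1+\sum_{i=1}^\infty\lambda^i\int_0^1\bar G^{*i}(y)\,dy\bigr)}, & x\in(1,\infty),\end{cases}$$ where all the series converge. (The remaining mass of the invariant distribution is an atom at $0$; in particular the invariant distribution is unique.) -/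

import Mathlib

open MeasureTheory ProbabilityTheory Set

noncomputable section

namespace BoundedWait

/-- The primitives of an `M/G/1` queue on `(Ω, P)`: `I n` is the time between the arrivals of
customers `n` and `n + 1` (customer `0` being a fictitious arrival at time `0`), exponential with
mean `1 / lam`, and `S n` is the service requirement of customer `n + 1`, with law `G`;
all of these random variables are independent. -/
structure IsMG1Input {Ω : Type*} [MeasurableSpace Ω] (P : Measure Ω) (lam : ℝ) (G : Measure ℝ)
    (I S : ℕ → Ω → ℝ) : Prop where
  measurable_I : ∀ n, Measurable (I n)
  measurable_S : ∀ n, Measurable (S n)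
  law_I : ∀ n, P.map (I n) = expMeasure lam
  law_S : ∀ n, P.map (S n) = G
  indep : iIndepFun (Sum.elim I S : ℕ ⊕ ℕ → Ω → ℝ) P

section Construction

variable {Ω : Type*} (I S : ℕ → Ω → ℝ)

/-- The arrival time of the `n`-th customer, with value `0` for `n = 0`. -/
def arrivalTime (n : ℕ) (ω : Ω) : ℝ := ∑ k ∈ Finset.range n, I k ω

/-- The workload of the queue with initial workload `x` immediately after the `n`-th arrival
(for `n = 0`: at time `0`). Between arrivals the workload decreases at unit rate until it
reaches `0`; an arriving customer is admitted exactly when the workload just before the arrival,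
which is the waiting time in line, is less than `1`. -/
def workloadAtArrival (x : ℝ) : ℕ → Ω → ℝ
  | 0, _ => x
  | n + 1, ω =>
    max (workloadAtArrival x n ω - I n ω) 0 +
      (if max (workloadAtArrival x n ω - I n ω) 0 < 1 then S n ω else 0)

/-- The number of arrivals in the time interval `(0, t]`. -/
def arrivalCount (t : ℝ) (ω : Ω) : ℕ := sSup {n : ℕ | arrivalTime I n ω ≤ t}

/-- The workload at time `t ≥ 0` of the queue with bounded waiting time and initial
workload `x`. -/
def workload (x t : ℝ) (ω : Ω) : ℝ :=
  max (workloadAtArrival I S x (arrivalCount I t ω) ω -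
    (t - arrivalTime I (arrivalCount I t ω) ω)) 0

end Construction

/-- `π` is an invariant distribution of the workload process: a probability measure on `[0, ∞)`
with `∫ P (V_t^x ∈ A) π(dx) = π(A)` for all times `t ≥ 0` and all Borel sets `A`. -/
structure IsInvariant {Ω : Type*} [MeasurableSpace Ω] (P : Measure Ω) (I S : ℕ → Ω → ℝ)
    (π : Measure ℝ) : Prop where
  isProbabilityMeasure : IsProbabilityMeasure π
  nonneg : π (Iio 0) = 0
  invariant : ∀ t : ℝ, 0 ≤ t → ∀ A : Set ℝ, MeasurableSet A →
    ∫⁻ x, P {ω | workload I S x t ω ∈ A} ∂π = π A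

/-- The tail `x ↦ G (x, ∞)` of the service time distribution. -/
def tail (G : Measure ℝ) (x : ℝ) : ℝ := G.real (Ioi x)

/-- The convolution powers of the tail of `G` on `(0, ∞)`: `tailConv G i` is the convolution of
`i + 1` copies of `tail G`. -/
def tailConv (G : Measure ℝ) : ℕ → ℝ → ℝ
  | 0, x => tail G x
  | i + 1, x => ∫ y in (0 : ℝ)..x, tail G (x - y) * tailConv G i y

/-- The normalizing constant of the invariant density. -/
def normalizer (lam : ℝ) (G : Measure ℝ) : ℝ :=
  1 + lam * (∫ s, s ∂G) *
    (1 + ∑' i : ℕ, lam ^ (i + 1) * ∫ y in (0 : ℝ)..1, tailConv G i y)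

/-- The invariant density on `(0, ∞)`. -/
def invariantDensity (lam : ℝ) (G : Measure ℝ) (x : ℝ) : ℝ :=
  if x ≤ 1 then
    (∑' i : ℕ, lam ^ (i + 1) * tailConv G i x) / normalizer lam G
  else
    (lam * tail G x +
      lam * ∑' i : ℕ, lam ^ (i + 1) * ∫ y in (0 : ℝ)..1, tail G (x - y) * tailConv G i y) /
      normalizer lam G

end BoundedWait

end

/-! The memoryless property reduces invariance to a fixed-point equation. Decomposing the workload
at time `t` by the last arrival in `(0, t]` and letting `t` tend to infinity, a law `π` on `[0, ∞)`
is invariant exactly when `π = stepLaw lam G π`: the workload an exponential time after an arrival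
that finds a workload of law `π` again has law `π` (`eq_stepLaw_of_isInvariant`,
`isInvariant_of_eq_stepLaw`).

Comparing tails turns this equation into a level crossing identity (`eq_stepLaw_iff_levelCrossing`):
on `(0, ∞)` the law `π` has density `λ ∫ G(z - x, ∞) π(dx)` at `z`, the integral running over `x ≤
z` with `x < 1`. Downcrossings of `z` occur at the rate given by the density, because the workload
drains at unit rate; upcrossings are caused by admitted customers.

With `α = π {0}`, the identity on `(0, 1]` is a Volterra equation, whose only bounded solution is
`α` times the sum `renewal` of the convolution powers of `λ Ḡ` (`eq_renewal_of_volterra`). Since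
customers finding a workload of at least 1 are rejected, the values on `(0, 1]` give the density
above 1 explicitly. Integrating the identity over `z` gives `1 - α = λ E(S) π[0, 1)`, and `π[0, 1) =
α (1 + ∫₀¹ renewal)`, so `α` is the inverse of the normalizer. Conversely, the measure with this
atom and density satisfies the identity, which gives existence. -/

namespace BoundedWait
open scoped ENNReal

/-! ### The Markov chain of arrival times and workloads at arrivals -/

section StateLaw

lemma lintegral_expMeasure (lam : ℝ) {f : ℝ → ℝ≥0∞} (hf : Measurable f) :
    ∫⁻ u, f u ∂(expMeasure lam) =
      ∫⁻ u in Ici 0, ENNReal.ofReal (lam * Real.exp (-(lam * u))) * f u := by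
  have h : expMeasure lam = volume.withDensity (exponentialPDF lam) := rfl
  have hm : Measurable (exponentialPDF lam) :=
    (measurable_exponentialPDFReal lam).ennreal_ofReal
  rw [h, lintegral_withDensity_eq_lintegral_mul _ hm hf, ← lintegral_indicator measurableSet_Ici]
  refine lintegral_congr fun u => ?_
  by_cases hu : 0 ≤ u
  · rw [indicator_of_mem (mem_Ici.2 hu), Pi.mul_apply, exponentialPDF_of_nonneg hu]
  · rw [indicator_of_notMem (by simpa using hu), Pi.mul_apply,
      exponentialPDF_of_neg (not_le.1 hu), zero_mul]

variable {Ω α : Type*} {I S : ℕ → Ω → ℝ}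

lemma measurable_arrivalTime_comp [MeasurableSpace α] {Y : α → Ω} (n : ℕ)
    (hI : ∀ k < n, Measurable fun a => I k (Y a)) :
    Measurable fun a => arrivalTime I n (Y a) :=
  Finset.measurable_sum _ fun k hk => hI k (Finset.mem_range.1 hk)

lemma measurable_workloadAtArrival_comp [MeasurableSpace α] {X : α → ℝ} {Y : α → Ω}
    (hX : Measurable X) (n : ℕ) (hI : ∀ k < n, Measurable fun a => I k (Y a))
    (hS : ∀ k < n, Measurable fun a => S k (Y a)) :
    Measurable fun a => workloadAtArrival I S (X a) n (Y a) := by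
  induction n with
  | zero => exact hX
  | succ n ih =>
    have h := ih (fun k hk => hI k (hk.trans n.lt_succ_self))
      (fun k hk => hS k (hk.trans n.lt_succ_self))
    have h1 : Measurable fun a => max (workloadAtArrival I S (X a) n (Y a) - I n (Y a)) 0 :=
      (h.sub (hI n n.lt_succ_self)).max measurable_const
    exact h1.add (Measurable.ite (measurableSet_lt h1 measurable_const)
      (hS n n.lt_succ_self) measurable_const)

lemma arrivalTime_succ (n : ℕ) (ω : Ω) :
    arrivalTime I (n + 1) ω = arrivalTime I n ω + I n ω :=
  Finset.sum_range_succ _ _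

variable [MeasurableSpace Ω] {P : Measure Ω} {lam : ℝ} {G : Measure ℝ}

namespace IsMG1Input

lemma measurable_state (h : IsMG1Input P lam G I S) (n : ℕ) :
    Measurable fun p : ℝ × Ω => (arrivalTime I n p.2, workloadAtArrival I S p.1 n p.2) :=
  (measurable_arrivalTime_comp n fun k _ => (h.measurable_I k).comp measurable_snd).prodMk
    (measurable_workloadAtArrival_comp measurable_fst n
      (fun k _ => (h.measurable_I k).comp measurable_snd)
      (fun k _ => (h.measurable_S k).comp measurable_snd))

lemma ae_nonneg (h : IsMG1Input P lam G I S) : ∀ᵐ ω ∂P, ∀ n, 0 ≤ I n ω := by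
  refine ae_all_iff.2 fun n => ?_
  refine ae_of_ae_map (p := fun u => 0 ≤ u) (h.measurable_I n).aemeasurable ?_
  rw [h.law_I n, ae_iff, ← lintegral_indicator_one (by measurability),
    lintegral_expMeasure _ (measurable_one.indicator (by measurability)),
    setLIntegral_congr_fun (g := fun _ => 0) measurableSet_Ici, lintegral_zero]
  intro u hu
  have : 0 ≤ u := hu
  simp [this]

/-- The state just after the `n`-th arrival is independent of the next interarrival time and
service requirement. -/
lemma indepFun_state (h : IsMG1Input P lam G I S) (x : ℝ) (n : ℕ) :
    IndepFun (fun ω => (arrivalTime I n ω, workloadAtArrival I S x n ω))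
      (fun ω => (I n ω, S n ω)) P := by
  set m : ℕ ⊕ ℕ → MeasurableSpace Ω := fun i =>
    MeasurableSpace.comap (Sum.elim I S i : Ω → ℝ) inferInstance with hm
  have hle : ∀ i, m i ≤ ‹MeasurableSpace Ω› := by
    rintro (k | k)
    · exact (h.measurable_I k).comap_le
    · exact (h.measurable_S k).comap_le
  -- The state after `n` arrivals is a function of the variables with index below `n`; the indexing
  -- from 0 makes `I n` and `S n` belong to the next customer.
  let A : Set (ℕ ⊕ ℕ) := {i | Sum.elim id id i < n}
  let B : Set (ℕ ⊕ ℕ) := {i | Sum.elim id id i = n}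
  have hAB : Disjoint A B := Set.disjoint_left.2 fun i hi hi' => (ne_of_lt hi) hi'
  have key := indep_iSup_of_disjoint hle h.indep hAB
  have hmeas : ∀ (C : Set (ℕ ⊕ ℕ)) i, i ∈ C →
      Measurable[⨆ j ∈ C, m j] (Sum.elim I S i : Ω → ℝ) := fun C i hi =>
    Measurable.mono (comap_measurable _) (le_iSup₂_of_le i hi le_rfl) le_rfl
  refine indep_of_indep_of_le_left (indep_of_indep_of_le_right key ?_) ?_
  · refine Measurable.comap_le ?_
    exact (hmeas B (Sum.inl n) rfl).prodMk (hmeas B (Sum.inr n) rfl)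
  · refine Measurable.comap_le ?_
    refine Measurable.prodMk ?_ ?_
    · exact @measurable_arrivalTime_comp _ _ _ (⨆ j ∈ A, m j) id n
        fun k hk => hmeas A (Sum.inl k) hk
    · exact @measurable_workloadAtArrival_comp _ _ _ _ (⨆ j ∈ A, m j) (fun _ => x) id
        (@measurable_const _ _ _ (⨆ j ∈ A, m j) x) n
        (fun k hk => hmeas A (Sum.inl k) hk) (fun k hk => hmeas A (Sum.inr k) hk)

lemma map_prodMk [IsProbabilityMeasure P] (h : IsMG1Input P lam G I S) (n : ℕ) :
    P.map (fun ω => (I n ω, S n ω)) = (expMeasure lam).prod G := by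
  have := h.indep.indepFun (i := Sum.inl n) (j := Sum.inr n) (by simp)
  have := (indepFun_iff_map_prod_eq_prod_map_map (h.measurable_I n).aemeasurable
    (h.measurable_S n).aemeasurable).1 this
  simpa [h.law_I, h.law_S] using this

end IsMG1Input

/-- The joint law of the `n`-th arrival time and the workload just after it, when the initial
workload has law `π`. -/
noncomputable def stateLaw (P : Measure Ω) (I S : ℕ → Ω → ℝ) (π : Measure ℝ) (n : ℕ) :
    Measure (ℝ × ℝ) :=
  (π.prod P).map fun p => (arrivalTime I n p.2, workloadAtArrival I S p.1 n p.2)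

namespace IsMG1Input


variable {π : Measure ℝ}

lemma stateLaw_ae_nonneg (h : IsMG1Input P lam G I S) (n : ℕ) :
    ∀ᵐ a ∂(stateLaw P I S π n), 0 ≤ a.1 := by
  refine (ae_map_iff (h.measurable_state n).aemeasurable
    (measurableSet_le measurable_const measurable_fst)).2 ?_
  have : ∀ᵐ p ∂(π.prod P), ∀ n, 0 ≤ I n p.2 :=
    Measure.quasiMeasurePreserving_snd.ae h.ae_nonneg
  filter_upwards [this] with p hp
  exact Finset.sum_nonneg fun k _ => hp k

variable [IsProbabilityMeasure P]

/-- For each fixed initial workload, the state and the next pair of inputs are independent, so their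
joint law is a product; integrating over the initial workload gives the claim. This is where all
later conditioning on the past comes from. -/
lemma lintegral_state_prod [IsProbabilityMeasure G] (h : IsMG1Input P lam G I S)
    (hlam : 0 < lam) (n : ℕ) {F : (ℝ × ℝ) × (ℝ × ℝ) → ℝ≥0∞} (hF : Measurable F) :
    ∫⁻ p, F ((arrivalTime I n p.2, workloadAtArrival I S p.1 n p.2), (I n p.2, S n p.2))
        ∂(π.prod P) =
      ∫⁻ a, ∫⁻ u, ∫⁻ s, F (a, (u, s)) ∂G ∂(expMeasure lam) ∂(stateLaw P I S π n) := by
  have := isProbabilityMeasure_expMeasure hlam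
  have hst := h.measurable_state n
  have hIS : Measurable fun ω => (I n ω, S n ω) := (h.measurable_I n).prodMk (h.measurable_S n)
  have hF1 : Measurable fun a => ∫⁻ b, F (a, b) ∂((expMeasure lam).prod G) :=
    hF.lintegral_prod_right'
  have hF2 : ∀ a, ∫⁻ b, F (a, b) ∂((expMeasure lam).prod G) =
      ∫⁻ u, ∫⁻ s, F (a, (u, s)) ∂G ∂(expMeasure lam) := fun a =>
    lintegral_prod _ (hF.comp measurable_prodMk_left).aemeasurable
  simp_rw [← hF2]
  rw [stateLaw, lintegral_map hF1 hst,
    lintegral_prod (fun p : ℝ × Ω => ∫⁻ b, F ((arrivalTime I n p.2,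
      workloadAtArrival I S p.1 n p.2), b) ∂((expMeasure lam).prod G))
      (hF1.comp hst).aemeasurable,
    lintegral_prod (fun p : ℝ × Ω => F ((arrivalTime I n p.2, workloadAtArrival I S p.1 n p.2),
      (I n p.2, S n p.2))) (hF.comp (hst.prodMk (hIS.comp measurable_snd))).aemeasurable]
  refine lintegral_congr fun x => ?_
  have hx : Measurable fun ω => (arrivalTime I n ω, workloadAtArrival I S x n ω) :=
    hst.comp measurable_prodMk_left
  have hmap := (indepFun_iff_map_prod_eq_prod_map_map hx.aemeasurable hIS.aemeasurable).1
    (h.indepFun_state x n)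
  rw [h.map_prodMk n] at hmap
  have : IsProbabilityMeasure
      (P.map fun ω => (arrivalTime I n ω, workloadAtArrival I S x n ω)) :=
    Measure.isProbabilityMeasure_map hx.aemeasurable
  calc _ = ∫⁻ q, F q ∂(P.map fun ω =>
        ((arrivalTime I n ω, workloadAtArrival I S x n ω), (I n ω, S n ω))) :=
        (lintegral_map hF (hx.prodMk hIS)).symm
    _ = _ := by
        rw [hmap, lintegral_prod _ hF.aemeasurable, lintegral_map hF1 hx]

instance [SFinite π] {n : ℕ} : SFinite (stateLaw P I S π n) := by
  unfold stateLaw; infer_instance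

lemma stateLaw_zero [SFinite π] : stateLaw P I S π 0 = (Measure.dirac 0).prod π := by
  have : (fun p : ℝ × Ω => (arrivalTime I 0 p.2, workloadAtArrival I S p.1 0 p.2)) =
      Prod.mk 0 ∘ Prod.fst := by
    ext p <;> simp [arrivalTime, workloadAtArrival]
  rw [stateLaw, this, ← Measure.map_map measurable_prodMk_left measurable_fst,
    Measure.map_fst_prod, measure_univ, one_smul, Measure.dirac_prod]

lemma lintegral_stateLaw_succ [IsProbabilityMeasure G] (h : IsMG1Input P lam G I S)
    (hlam : 0 < lam) (n : ℕ) {F : ℝ × ℝ → ℝ≥0∞} (hF : Measurable F) :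
    ∫⁻ a, F a ∂(stateLaw P I S π (n + 1)) =
      ∫⁻ a, ∫⁻ u, ∫⁻ s, F (a.1 + u, max (a.2 - u) 0 + if max (a.2 - u) 0 < 1 then s else 0)
        ∂G ∂(expMeasure lam) ∂(stateLaw P I S π n) := by
  rw [stateLaw, lintegral_map hF (h.measurable_state _)]
  have hm : Measurable fun q : (ℝ × ℝ) × (ℝ × ℝ) =>
      F (q.1.1 + q.2.1,
        max (q.1.2 - q.2.1) 0 + if max (q.1.2 - q.2.1) 0 < 1 then q.2.2 else 0) := by
    have h1 : Measurable fun q : (ℝ × ℝ) × (ℝ × ℝ) => max (q.1.2 - q.2.1) 0 := by fun_prop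
    exact hF.comp (((by fun_prop : Measurable fun q : (ℝ × ℝ) × (ℝ × ℝ) => q.1.1 + q.2.1)).prodMk
      (h1.add (Measurable.ite (measurableSet_lt h1 measurable_const) (by fun_prop)
        measurable_const)))
  rw [← h.lintegral_state_prod hlam n hm]
  simp only [arrivalTime_succ, workloadAtArrival]

end IsMG1Input
end StateLaw

/-! ### The law of the workload on the event of exactly `n` arrivals -/

section Occupation

/-- The workload just after the arrival of a customer with service requirement `s` who finds the
workload `y`. -/
noncomputable def accept (y s : ℝ) : ℝ := y + if y < 1 then s else 0

@[fun_prop]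
lemma measurable_accept {α : Type*} [MeasurableSpace α] {f g : α → ℝ} (hf : Measurable f)
    (hg : Measurable g) : Measurable fun a => accept (f a) (g a) :=
  hf.add (Measurable.ite (measurableSet_lt hf measurable_const) hg measurable_const)

/-- The expectation of `f` at the workload a time `v` after an arrival which finds the workload
`y`, if there is no other arrival in between. -/
noncomputable def afterArrival (G : Measure ℝ) (v : ℝ) (f : ℝ → ℝ≥0∞) (y : ℝ) : ℝ≥0∞ :=
  ∫⁻ s, f (max (accept y s - v) 0) ∂G

lemma measurable_afterArrival {α : Type*} [MeasurableSpace α] {G : Measure ℝ} [SFinite G]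
    {f : ℝ → ℝ≥0∞} (hf : Measurable f) {v y : α → ℝ} (hv : Measurable v) (hy : Measurable y) :
    Measurable fun a => afterArrival G (v a) f (y a) := by
  have : Measurable fun p : α × ℝ => f (max (accept (y p.1) p.2 - v p.1) 0) := by fun_prop
  exact this.lintegral_prod_right'

variable {Ω : Type*} [MeasurableSpace Ω] {I S : ℕ → Ω → ℝ} {P : Measure Ω} {lam : ℝ}
  {G π : Measure ℝ}

/-- The weight `e ^ (- lam (t - s))` on `s ≤ t`: the probability that there is no arrival in
`(s, t]`. -/
noncomputable def survival (lam t s : ℝ) : ℝ≥0∞ :=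
  if s ≤ t then ENNReal.ofReal (Real.exp (-(lam * (t - s)))) else 0

@[fun_prop]
lemma measurable_survival {α : Type*} [MeasurableSpace α] {t s : α → ℝ} (ht : Measurable t)
    (hs : Measurable s) : Measurable fun a => survival lam (t a) (s a) :=
  Measurable.ite (measurableSet_le hs ht) (by fun_prop) measurable_const

/-- The law of the workload at time `t` on the event that there are exactly `n` arrivals in
`(0, t]`. -/
noncomputable def occLaw (P : Measure Ω) (I S : ℕ → Ω → ℝ) (lam : ℝ) (π : Measure ℝ) (n : ℕ)
    (t : ℝ) : Measure ℝ :=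
  ((stateLaw P I S π n).withDensity fun a => survival lam t a.1).map
    fun a => max (a.2 - (t - a.1)) 0

lemma lintegral_occLaw (n : ℕ) (t : ℝ) {f : ℝ → ℝ≥0∞} (hf : Measurable f) :
    ∫⁻ y, f y ∂(occLaw P I S lam π n t) =
      ∫⁻ a, survival lam t a.1 * f (max (a.2 - (t - a.1)) 0) ∂(stateLaw P I S π n) := by
  rw [occLaw, lintegral_map hf (by fun_prop),
    lintegral_withDensity_eq_lintegral_mul _ (by fun_prop) (by fun_prop)]
  rfl

namespace IsMG1Input
variable [IsProbabilityMeasure P] [SFinite π]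

lemma lintegral_occLaw_zero {t : ℝ} (ht : 0 ≤ t) {f : ℝ → ℝ≥0∞} (hf : Measurable f) :
    ∫⁻ y, f y ∂(occLaw P I S lam π 0 t) =
      ENNReal.ofReal (Real.exp (-(lam * t))) * ∫⁻ x, f (max (x - t) 0) ∂π := by
  have hm : Measurable fun a : ℝ × ℝ => survival lam t a.1 * f (max (a.2 - (t - a.1)) 0) := by
    fun_prop
  rw [lintegral_occLaw 0 t hf, stateLaw_zero, lintegral_prod _ hm.aemeasurable,
    lintegral_dirac' _ hm.lintegral_prod_right']
  simp only [survival, if_pos ht, sub_zero]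
  exact lintegral_const_mul _ (by fun_prop)

variable [IsProbabilityMeasure G]

/-- Here `v` is the time elapsed since the last arrival. Just before that arrival, at time `t - v`,
exactly `n` customers have come, and the factor `λ e^(-λv)` combines the arrival rate with the
absence of arrivals afterwards. -/
lemma lintegral_occLaw_succ (h : IsMG1Input P lam G I S) (hlam : 0 < lam) (n : ℕ) (t : ℝ)
    {f : ℝ → ℝ≥0∞} (hf : Measurable f) :
    ∫⁻ y, f y ∂(occLaw P I S lam π (n + 1) t) =
      ∫⁻ v in Icc 0 t, ENNReal.ofReal (lam * Real.exp (-(lam * v))) *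
        ∫⁻ y, afterArrival G v f y ∂(occLaw P I S lam π n (t - v)) := by
  have hk : Measurable fun p : ℝ × ℝ => afterArrival G p.1 f p.2 :=
    measurable_afterArrival hf measurable_fst measurable_snd
  have hkc : ∀ v, Measurable (afterArrival G v f) := fun v => hk.comp measurable_prodMk_left
  have hexp : ∀ a b : ℝ, ENNReal.ofReal (lam * Real.exp (-(lam * a))) *
      ENNReal.ofReal (Real.exp (-(lam * b))) =
      ENNReal.ofReal (lam * Real.exp (-(lam * (a + b)))) := fun a b => by
    rw [← ENNReal.ofReal_mul (by positivity), mul_assoc, ← Real.exp_add]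
    ring_nf
  -- With `u` the last interarrival time, substitute `v = t - a.1 - u`. The density of `u` and the
  -- survival weight multiply to `λ e^(-λ(t - a.1))`, which no longer depends on `v` and can be
  -- split again as `λ e^(-λv)` times survival from `a.1` to `t - v`.
  have hleft : ∀ a : ℝ × ℝ,
      ∫⁻ u, ∫⁻ s, survival lam t (a.1 + u) *
          f (max ((max (a.2 - u) 0 + if max (a.2 - u) 0 < 1 then s else 0) - (t - (a.1 + u))) 0)
          ∂G ∂(expMeasure lam) =
        ∫⁻ v, (Icc 0 (t - a.1)).indicator (fun v => ENNReal.ofReal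
          (lam * Real.exp (-(lam * (t - a.1)))) *
            afterArrival G v f (max (a.2 - (t - a.1 - v)) 0)) v := by
    intro a
    have h1 : ∀ u, ∫⁻ s, survival lam t (a.1 + u) *
          f (max ((max (a.2 - u) 0 + if max (a.2 - u) 0 < 1 then s else 0) - (t - (a.1 + u))) 0)
          ∂G = survival lam t (a.1 + u) *
            afterArrival G (t - a.1 - u) f (max (a.2 - u) 0) := by
      intro u
      rw [afterArrival, ← lintegral_const_mul _ (by fun_prop)]
      simp only [accept, sub_sub]
    simp_rw [h1]
    rw [lintegral_expMeasure lam (by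
        have := measurable_afterArrival (G := G) hf
          (v := fun u : ℝ => t - a.1 - u) (y := fun u => max (a.2 - u) 0)
          (by fun_prop) (by fun_prop)
        fun_prop), ← lintegral_indicator measurableSet_Ici,
      ← lintegral_sub_left_eq_self _ (t - a.1)]
    refine lintegral_congr fun v => ?_
    by_cases hv : v ∈ Icc 0 (t - a.1)
    · have h2 : t - a.1 - v ∈ Ici (0 : ℝ) := by simpa using hv.2
      have h3 : a.1 + (t - a.1 - v) ≤ t := by linarith [hv.1]
      rw [indicator_of_mem hv, indicator_of_mem h2, survival, if_pos h3, ← mul_assoc, hexp]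
      congr 3
      · ring_nf
      · ring
    · rw [indicator_of_notMem hv]
      by_cases h2 : t - a.1 - v ∈ Ici (0 : ℝ)
      · have h3 : ¬ a.1 + (t - a.1 - v) ≤ t := by
          intro h3
          exact hv ⟨by linarith, by simpa using h2⟩
        rw [indicator_of_mem h2, survival, if_neg h3]
        simp
      · rw [indicator_of_notMem h2]
  rw [lintegral_occLaw _ _ hf, h.lintegral_stateLaw_succ hlam n (by fun_prop)]
  simp_rw [hleft]
  have hmeas : Measurable fun p : (ℝ × ℝ) × ℝ =>
      (Icc 0 (t - p.1.1)).indicator (fun v => ENNReal.ofReal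
          (lam * Real.exp (-(lam * (t - p.1.1)))) *
            afterArrival G v f (max (p.1.2 - (t - p.1.1 - v)) 0)) p.2 := by
    have h1 : Measurable fun p : (ℝ × ℝ) × ℝ => ENNReal.ofReal
          (lam * Real.exp (-(lam * (t - p.1.1)))) *
            afterArrival G p.2 f (max (p.1.2 - (t - p.1.1 - p.2)) 0) := by
      have := measurable_afterArrival (G := G) hf
          (v := fun p : (ℝ × ℝ) × ℝ => p.2) (y := fun p => max (p.1.2 - (t - p.1.1 - p.2)) 0)
          (by fun_prop) (by fun_prop)
      fun_prop
    exact h1.indicator (s := {p : (ℝ × ℝ) × ℝ | p.2 ∈ Icc 0 (t - p.1.1)})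
      ((measurableSet_le measurable_const measurable_snd).inter
        (measurableSet_le measurable_snd (by fun_prop)))
  rw [lintegral_lintegral_swap hmeas.aemeasurable, ← lintegral_indicator measurableSet_Icc]
  refine lintegral_congr fun v => ?_
  by_cases hv : v ∈ Icc 0 t
  · rw [indicator_of_mem hv, lintegral_occLaw _ _ (hkc v), ← lintegral_const_mul _ (by
      have := hkc v
      fun_prop)]
    refine lintegral_congr fun a => ?_
    by_cases ha : a.1 ≤ t - v
    · rw [indicator_of_mem (show v ∈ Icc 0 (t - a.1) from ⟨hv.1, by linarith⟩), survival, if_pos ha, ← mul_assoc, hexp]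
      congr 3
      · ring_nf
      · ring
    · rw [indicator_of_notMem (fun h' : v ∈ Icc 0 (t - a.1) => ha (by linarith [h'.2])), survival, if_neg ha]
      simp
  · rw [indicator_of_notMem hv]
    -- Arrival times are almost surely nonnegative, so no `v` outside `[0, t]` contributes.
    refine (lintegral_congr_ae ?_).trans lintegral_zero
    filter_upwards [h.stateLaw_ae_nonneg n] with a ha
    exact indicator_of_notMem (fun h' => hv ⟨h'.1, by linarith [h'.2]⟩) _

/-- The Poisson probabilities: for `f = 1` the exponentials in the recursion combine to `e^(-λt)`,
leaving the integral of `(t - v) ^ n`. -/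
lemma occLaw_univ [IsProbabilityMeasure π] (h : IsMG1Input P lam G I S) (hlam : 0 < lam) (n : ℕ)
    {t : ℝ} (ht : 0 ≤ t) :
    occLaw P I S lam π n t univ =
      ENNReal.ofReal (Real.exp (-(lam * t)) * ((lam * t) ^ n / n.factorial)) := by
  induction n generalizing t with
  | zero =>
    have := lintegral_occLaw_zero (P := P) (I := I) (S := S) (π := π) (lam := lam) ht
      measurable_one
    simpa using this
  | succ n ih =>
    have h1 := h.lintegral_occLaw_succ (π := π) hlam n t measurable_one
    have h2 : ∀ v ∈ Icc 0 t, ENNReal.ofReal (lam * Real.exp (-(lam * v))) *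
        ∫⁻ y, afterArrival G v 1 y ∂(occLaw P I S lam π n (t - v)) =
        ENNReal.ofReal (lam * (Real.exp (-(lam * t)) * ((lam * (t - v)) ^ n / n.factorial))) := by
      intro v hv
      have h3 : afterArrival G v 1 = 1 := by ext y; simp [afterArrival]
      rw [h3]
      simp only [Pi.one_apply, lintegral_one, ih (sub_nonneg.2 hv.2)]
      rw [← ENNReal.ofReal_mul (by positivity)]
      congr 1
      have : Real.exp (-(lam * t)) = Real.exp (-(lam * v)) * Real.exp (-(lam * (t - v))) := by
        rw [← Real.exp_add]; ring_nf
      rw [this]; ring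
    rw [setLIntegral_congr_fun measurableSet_Icc h2] at h1
    simp only [Pi.one_apply, lintegral_one] at h1
    rw [h1, ← ofReal_integral_eq_lintegral_ofReal]
    · congr 1
      rw [integral_Icc_eq_integral_Ioc, ← intervalIntegral.integral_of_le ht]
      have h4 : ∀ v : ℝ, lam * (Real.exp (-(lam * t)) * ((lam * (t - v)) ^ n / n.factorial)) =
          (lam ^ (n + 1) * Real.exp (-(lam * t)) / n.factorial) * (t - v) ^ n := by
        intro v; rw [mul_pow]; ring
      simp_rw [h4]
      rw [intervalIntegral.integral_const_mul,
        intervalIntegral.integral_comp_sub_left (fun v => v ^ n) t]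
      simp only [sub_self, sub_zero, integral_pow, Nat.factorial_succ, Nat.cast_mul, Nat.cast_succ,
        mul_pow]
      have : (n.factorial : ℝ) ≠ 0 := by positivity
      have : (n + 1 : ℝ) ≠ 0 := by positivity
      field_simp
      simp
    · exact (Continuous.continuousOn (by fun_prop)).integrableOn_Icc
    · refine (ae_restrict_iff' measurableSet_Icc).2 (.of_forall fun v hv => ?_)
      have := hv.2
      have : 0 ≤ lam * (t - v) := mul_nonneg hlam.le (by linarith)
      positivity

lemma tsum_occLaw_univ [IsProbabilityMeasure π] (h : IsMG1Input P lam G I S) (hlam : 0 < lam)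
    {t : ℝ} (ht : 0 ≤ t) : ∑' n, occLaw P I S lam π n t univ = 1 := by
  simp_rw [fun n => h.occLaw_univ (π := π) hlam n ht]
  have h1 : HasSum (fun n : ℕ => (lam * t) ^ n / n.factorial) (Real.exp (lam * t)) := by
    rw [Real.exp_eq_exp_ℝ]
    exact NormedSpace.expSeries_div_hasSum_exp (lam * t)
  have h2 := h1.mul_left (Real.exp (-(lam * t)))
  rw [← Real.exp_add, neg_add_cancel, Real.exp_zero] at h2
  rw [← ENNReal.ofReal_tsum_of_nonneg (fun n => by positivity) h2.summable, h2.tsum_eq,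
    ENNReal.ofReal_one]

end IsMG1Input
end Occupation

/-! ### The law of the workload at a fixed time -/

section WorkloadLaw

lemma expMeasure_Ioi {lam c : ℝ} (hlam : 0 < lam) (hc : 0 ≤ c) :
    expMeasure lam (Ioi c) = ENNReal.ofReal (Real.exp (-(lam * c))) := by
  have := isProbabilityMeasure_expMeasure hlam
  have h1 : expMeasure lam (Iic c) = ENNReal.ofReal (1 - Real.exp (-(lam * c))) := by
    rw [← ofReal_cdf, cdf_expMeasure_eq hlam, if_pos hc]
  have h2 : Real.exp (-(lam * c)) ≤ 1 := Real.exp_le_one_iff.2 (by nlinarith)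
  rw [← compl_Iic, prob_compl_eq_one_sub measurableSet_Iic, h1, ← ENNReal.ofReal_one,
    ← ENNReal.ofReal_sub _ (by linarith)]
  congr 1
  ring

variable {Ω : Type*} {I S : ℕ → Ω → ℝ}

lemma arrivalTime_monotone {ω : Ω} (hI : ∀ n, 0 ≤ I n ω) :
    Monotone fun n => arrivalTime I n ω :=
  monotone_nat_of_le_succ fun n => by
    rw [arrivalTime_succ]
    exact le_add_of_nonneg_right (hI n)

lemma arrivalCount_eq {ω : Ω} (hI : ∀ n, 0 ≤ I n ω) {n : ℕ} {t : ℝ}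
    (h1 : arrivalTime I n ω ≤ t) (h2 : t < arrivalTime I n ω + I n ω) :
    arrivalCount I t ω = n := by
  rw [← arrivalTime_succ] at h2
  have : {m : ℕ | arrivalTime I m ω ≤ t} = Iic n := by
    ext m
    refine ⟨fun hm => ?_, fun hm => (arrivalTime_monotone hI hm).trans h1⟩
    by_contra hmn
    exact absurd (h2.trans_le (arrivalTime_monotone hI (Nat.succ_le_of_lt (not_le.1 hmn))))
      (not_lt.2 hm)
  rw [arrivalCount, this, csSup_Iic]

/-- The event that there are exactly `n` arrivals in `(0, t]` and that the workload at time `t`,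
for initial workload `x`, lies in `A`. -/
def countEvent (I S : ℕ → Ω → ℝ) (t : ℝ) (A : Set ℝ) (n : ℕ) (x : ℝ) : Set Ω :=
  {ω | arrivalTime I n ω ≤ t ∧ t < arrivalTime I n ω + I n ω ∧
    max (workloadAtArrival I S x n ω - (t - arrivalTime I n ω)) 0 ∈ A}

variable [MeasurableSpace Ω] {P : Measure Ω} {lam : ℝ} {G π : Measure ℝ}

namespace IsMG1Input

lemma measurableSet_countEvent_prod (h : IsMG1Input P lam G I S) (t : ℝ) {A : Set ℝ}
    (hA : MeasurableSet A) (n : ℕ) :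
    MeasurableSet {p : ℝ × Ω | p.2 ∈ countEvent I S t A n p.1} := by
  have h1 := h.measurable_state n
  have hT : Measurable fun p : ℝ × Ω => arrivalTime I n p.2 := measurable_fst.comp h1
  have hW : Measurable fun p : ℝ × Ω => workloadAtArrival I S p.1 n p.2 := measurable_snd.comp h1
  have hI : Measurable fun p : ℝ × Ω => I n p.2 := (h.measurable_I n).comp measurable_snd
  have hV : Measurable fun p : ℝ × Ω =>
      max (workloadAtArrival I S p.1 n p.2 - (t - arrivalTime I n p.2)) 0 := by fun_prop
  exact (measurableSet_le hT measurable_const).inter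
    ((measurableSet_lt measurable_const (hT.add hI)).inter (hV hA))

lemma measurableSet_countEvent (h : IsMG1Input P lam G I S) (t : ℝ) {A : Set ℝ}
    (hA : MeasurableSet A) (n : ℕ) (x : ℝ) : MeasurableSet (countEvent I S t A n x) :=
  measurable_prodMk_left (x := x) (h.measurableSet_countEvent_prod t hA n)

lemma aedisjoint_countEvent (h : IsMG1Input P lam G I S) (t : ℝ) (A : Set ℝ) (x : ℝ) :
    Pairwise (Function.onFun (AEDisjoint P) fun n => countEvent I S t A n x) := by
  intro n m hnm
  refine measure_mono_null (fun ω hω => ?_) (ae_iff.1 h.ae_nonneg)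
  intro hI
  exact hnm ((arrivalCount_eq hI hω.1.1 hω.1.2.1).symm.trans
    (arrivalCount_eq hI hω.2.1 hω.2.2.1))

variable [IsProbabilityMeasure P] [IsProbabilityMeasure G]

/-- The survival weight in `occLaw` is the probability that `I n`, which is independent of the
state, exceeds `t - a.1`; integrating out `I n` turns the event into the weight. -/
lemma occLaw_apply (h : IsMG1Input P lam G I S) (hlam : 0 < lam) (t : ℝ) {A : Set ℝ}
    (hA : MeasurableSet A) (n : ℕ) :
    occLaw P I S lam π n t A = ∫⁻ x, P (countEvent I S t A n x) ∂π := by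
  have hf : Measurable (A.indicator (1 : ℝ → ℝ≥0∞)) := measurable_one.indicator hA
  have hprod : ∫⁻ x, P (countEvent I S t A n x) ∂π =
      (π.prod P) {p : ℝ × Ω | p.2 ∈ countEvent I S t A n p.1} :=
    (Measure.prod_apply (h.measurableSet_countEvent_prod t hA n)).symm
  rw [hprod, ← lintegral_indicator_one hA,
    lintegral_occLaw _ _ hf, ← lintegral_indicator_one (h.measurableSet_countEvent_prod t hA n)]
  let B : Set ((ℝ × ℝ) × (ℝ × ℝ)) := {q | q.1.1 ≤ t ∧ t < q.1.1 + q.2.1 ∧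
    max (q.1.2 - (t - q.1.1)) 0 ∈ A}
  have hB : MeasurableSet B := by
    have hV : Measurable fun q : (ℝ × ℝ) × (ℝ × ℝ) => max (q.1.2 - (t - q.1.1)) 0 := by fun_prop
    have h1 : Measurable fun q : (ℝ × ℝ) × (ℝ × ℝ) => q.1.1 := by fun_prop
    have h2 : Measurable fun q : (ℝ × ℝ) × (ℝ × ℝ) => q.2.1 := by fun_prop
    exact (measurableSet_le h1 measurable_const).inter
      ((measurableSet_lt measurable_const (h1.add h2)).inter (hV hA))
  refine Eq.trans ?_
    (h.lintegral_state_prod (π := π) hlam n (F := B.indicator 1) (measurable_one.indicator hB)).symm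
  refine lintegral_congr fun a => ?_
  have h1 : ∀ u, ∫⁻ s, B.indicator (1 : (ℝ × ℝ) × (ℝ × ℝ) → ℝ≥0∞) (a, (u, s)) ∂G =
      (Ioi (t - a.1)).indicator (fun _ => if a.1 ≤ t then
        A.indicator (1 : ℝ → ℝ≥0∞) (max (a.2 - (t - a.1)) 0) else 0) u := by
    intro u
    have : ∀ s, B.indicator (1 : (ℝ × ℝ) × (ℝ × ℝ) → ℝ≥0∞) (a, (u, s)) =
        (Ioi (t - a.1)).indicator (fun _ => if a.1 ≤ t then
        A.indicator (1 : ℝ → ℝ≥0∞) (max (a.2 - (t - a.1)) 0) else 0) u := by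
      intro s
      have hmem : (a, (u, s)) ∈ B ↔ a.1 ≤ t ∧ t < a.1 + u ∧ max (a.2 - (t - a.1)) 0 ∈ A := Iff.rfl
      by_cases h1 : a.1 ≤ t <;> by_cases h2 : t < a.1 + u <;>
        by_cases h3 : max (a.2 - (t - a.1)) 0 ∈ A <;>
        simp [-lt_sup_iff, -sup_le_iff, h3, Set.indicator, hmem, sub_lt_iff_lt_add', h1, h2]
    simp_rw [this]
    simp
  simp_rw [h1]
  rw [lintegral_indicator_const measurableSet_Ioi]
  by_cases ha : a.1 ≤ t
  · rw [expMeasure_Ioi hlam (sub_nonneg.2 ha), survival, if_pos ha, if_pos ha, mul_comm]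
  · rw [survival, if_neg ha, if_neg ha, zero_mul, zero_mul]

/-- Arrivals almost surely do not accumulate before `t`, because the Poisson masses sum to 1. This
excludes the default value 0 that `sSup` in `arrivalCount` takes on unbounded sets. The initial
workload is irrelevant to the count, hence the choice of a point mass. -/
lemma ae_exists_count (h : IsMG1Input P lam G I S) (hlam : 0 < lam) {t : ℝ} (ht : 0 ≤ t) :
    ∀ᵐ ω ∂P, ∃ n, arrivalTime I n ω ≤ t ∧ t < arrivalTime I n ω + I n ω := by
  have h1 := h.tsum_occLaw_univ (π := Measure.dirac 0) hlam ht
  simp_rw [h.occLaw_apply (π := Measure.dirac 0) hlam t MeasurableSet.univ, lintegral_dirac] at h1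
  have hm := fun n => h.measurableSet_countEvent t MeasurableSet.univ n 0
  rw [← measure_iUnion₀ (h.aedisjoint_countEvent t univ 0)
    (fun n => (hm n).nullMeasurableSet)] at h1
  have h2 := (prob_compl_eq_zero_iff (MeasurableSet.iUnion hm)).2 h1
  filter_upwards [measure_eq_zero_iff_ae_notMem.1 h2] with ω hω
  obtain ⟨n, hn⟩ := mem_iUnion.1 (not_not.1 hω)
  exact ⟨n, hn.1, hn.2.1⟩

/-- The law of the workload at time `t`, decomposed according to the number of arrivals. -/
lemma lintegral_workload (h : IsMG1Input P lam G I S) (hlam : 0 < lam) {t : ℝ} (ht : 0 ≤ t)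
    {A : Set ℝ} (hA : MeasurableSet A) :
    ∫⁻ x, P {ω | workload I S x t ω ∈ A} ∂π =
      Measure.sum (fun n => occLaw P I S lam π n t) A := by
  have h1 : ∀ x, P {ω | workload I S x t ω ∈ A} = ∑' n, P (countEvent I S t A n x) := by
    intro x
    rw [← measure_iUnion₀ (h.aedisjoint_countEvent t A x)
      (fun n => (h.measurableSet_countEvent t hA n x).nullMeasurableSet)]
    refine measure_congr (Filter.eventuallyEq_set.2 ?_)
    filter_upwards [h.ae_nonneg, h.ae_exists_count hlam ht] with ω hI ⟨n, hn1, hn2⟩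
    simp only [mem_iUnion, workload, arrivalCount_eq hI hn1 hn2]
    refine ⟨fun hω => ⟨n, hn1, hn2, hω⟩, fun ⟨m, hm1, hm2, hω⟩ => ?_⟩
    rw [← arrivalCount_eq hI hn1 hn2, arrivalCount_eq hI hm1 hm2]
    exact hω
  rw [Measure.sum_apply _ hA]
  simp_rw [h1, h.occLaw_apply (π := π) hlam t hA]
  exact lintegral_tsum fun n =>
    (measurable_measure_prodMk_left (h.measurableSet_countEvent_prod t hA n)).aemeasurable

end IsMG1Input
end WorkloadLaw

/-! ### The one-step fixed-point equation -/

section Stationary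

/-- The law of the workload an exponential time after an arrival which finds a workload of
law `π`. -/
noncomputable def stepLaw (lam : ℝ) (G π : Measure ℝ) : Measure ℝ :=
  ((expMeasure lam).prod (π.prod G)).map fun p => max (accept p.2.1 p.2.2 - p.1) 0

variable {lam : ℝ} {G π : Measure ℝ}

lemma measurable_step : Measurable fun p : ℝ × ℝ × ℝ => max (accept p.2.1 p.2.2 - p.1) 0 := by
  fun_prop

lemma isProbabilityMeasure_stepLaw [IsProbabilityMeasure π] [IsProbabilityMeasure G]
    (hlam : 0 < lam) : IsProbabilityMeasure (stepLaw lam G π) :=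
  have := isProbabilityMeasure_expMeasure hlam
  Measure.isProbabilityMeasure_map measurable_step.aemeasurable

variable [SFinite G] [SFinite π]

lemma lintegral_stepLaw {f : ℝ → ℝ≥0∞} (hf : Measurable f) :
    ∫⁻ y, f y ∂(stepLaw lam G π) =
      ∫⁻ v in Ici 0, ENNReal.ofReal (lam * Real.exp (-(lam * v))) *
        ∫⁻ y, afterArrival G v f y ∂π := by
  have hk : Measurable fun p : ℝ × ℝ => afterArrival G p.1 f p.2 :=
    measurable_afterArrival hf measurable_fst measurable_snd
  have hm := hf.comp measurable_step
  rw [stepLaw, lintegral_map hf measurable_step,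
    ← lintegral_expMeasure lam hk.lintegral_prod_right']
  refine (lintegral_prod _ hm.aemeasurable).trans ?_
  refine lintegral_congr fun v => ?_
  exact lintegral_prod _ (hm.comp measurable_prodMk_left).aemeasurable

/-- The memoryless property: conditioning on whether the exponential time exceeds `t`. -/
lemma lintegral_stepLaw_split {t : ℝ} (ht : 0 ≤ t) {f : ℝ → ℝ≥0∞} (hf : Measurable f) :
    ∫⁻ y, f y ∂(stepLaw lam G π) =
      ENNReal.ofReal (Real.exp (-(lam * t))) * ∫⁻ x, f (max (x - t) 0) ∂(stepLaw lam G π) +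
      ∫⁻ v in Icc 0 t, ENNReal.ofReal (lam * Real.exp (-(lam * v))) *
        ∫⁻ y, afterArrival G v f y ∂π := by
  have hk : Measurable fun p : ℝ × ℝ => afterArrival G p.1 f p.2 :=
    measurable_afterArrival hf measurable_fst measurable_snd
  have hk' : Measurable fun v : ℝ => ∫⁻ y, afterArrival G v f y ∂π := hk.lintegral_prod_right'
  have hft : Measurable fun x => f (max (x - t) 0) := by fun_prop
  have hunion : Ici (0 : ℝ) = Icc 0 t ∪ Ioi t := (Icc_union_Ioi_eq_Ici ht).symm
  rw [lintegral_stepLaw hf, lintegral_stepLaw hft, hunion,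
    lintegral_union measurableSet_Ioi (by
      rw [Set.disjoint_left]; exact fun x hx hx' => not_lt.2 hx.2 hx'), add_comm, ← hunion]
  congr 1
  rw [setLIntegral_congr Ioi_ae_eq_Ici, ← lintegral_indicator measurableSet_Ici,
    ← lintegral_add_right_eq_self _ t, ← lintegral_indicator measurableSet_Ici,
    ← lintegral_const_mul]
  · refine lintegral_congr fun v => ?_
    by_cases hv : 0 ≤ v
    · rw [indicator_of_mem (show v + t ∈ Ici t by simpa using hv),
        indicator_of_mem (show v ∈ Ici (0 : ℝ) from hv), ← mul_assoc,
        ← ENNReal.ofReal_mul (by positivity)]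
      congr 1
      · rw [mul_left_comm, ← Real.exp_add]
        ring_nf
      · refine lintegral_congr fun y => ?_
        refine lintegral_congr fun s => ?_
        congr 1
        -- Draining for time `v` and then for time `t`, with reflection at 0 each time, equals
        -- draining for time `v + t` with one reflection.
        rcases le_total (accept y s - v) 0 with h | h
        · rw [max_eq_right h, max_eq_right (by linarith), max_eq_right (by linarith)]
        · rw [max_eq_left h, sub_sub]
    · rw [indicator_of_notMem (by simpa using hv), indicator_of_notMem (by simpa using hv),
        mul_zero]
  · have hk'' : Measurable fun v : ℝ => ∫⁻ y, afterArrival G v (fun x => f (max (x - t) 0)) y ∂π :=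
      (measurable_afterArrival (G := G) (v := fun p : ℝ × ℝ => p.1) (y := fun p => p.2) hft
        measurable_fst measurable_snd).lintegral_prod_right'
    exact Measurable.indicator (by fun_prop) measurableSet_Ici

end Stationary

/-! ### Invariant laws are the fixed points of `stepLaw` -/

section Invariance

variable {Ω : Type*} {I S : ℕ → Ω → ℝ} [MeasurableSpace Ω] {P : Measure Ω} {lam : ℝ}
  {G π : Measure ℝ} [IsProbabilityMeasure P] [IsProbabilityMeasure G]

lemma measurable_occLaw_integrand [SFinite π] (n : ℕ) (t : ℝ) {f : ℝ → ℝ≥0∞}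
    (hf : Measurable f) :
    Measurable fun v : ℝ => ENNReal.ofReal (lam * Real.exp (-(lam * v))) *
      ∫⁻ y, afterArrival G v f y ∂(occLaw P I S lam π n (t - v)) := by
  have hk : Measurable fun p : ℝ × ℝ => afterArrival G p.1 f p.2 :=
    measurable_afterArrival hf measurable_fst measurable_snd
  have hkc : ∀ v, Measurable (afterArrival G v f) := fun v => hk.comp measurable_prodMk_left
  simp_rw [fun v => lintegral_occLaw (P := P) (I := I) (S := S) (lam := lam) (π := π) n (t - v)
    (hkc v)]
  have hm : Measurable fun p : ℝ × (ℝ × ℝ) => survival lam (t - p.1) p.2.1 *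
      afterArrival G p.1 f (max (p.2.2 - (t - p.1 - p.2.1)) 0) := by
    have := measurable_afterArrival (G := G) hf (v := fun p : ℝ × (ℝ × ℝ) => p.1)
      (y := fun p => max (p.2.2 - (t - p.1 - p.2.1)) 0) (by fun_prop) (by fun_prop)
    fun_prop
  have := hm.lintegral_prod_right' (ν := stateLaw P I S π n)
  fun_prop

namespace IsMG1Input

/-- Summed over `n`, the recursion for `occLaw` has the invariant law `π` on both sides, since the
workload at time `t - v` also has law `π`. The term without arrivals is at most `e^(-λt)` and
vanishes as `t` grows; the rest is at most `stepLaw`. An inequality suffices, both measures having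
mass 1. -/
lemma eq_stepLaw_of_isInvariant (h : IsMG1Input P lam G I S) (hlam : 0 < lam)
    (hπ : IsInvariant P I S π) : π = stepLaw lam G π := by
  have := hπ.isProbabilityMeasure
  have := isProbabilityMeasure_stepLaw (G := G) (π := π) hlam
  have hsum : ∀ t, 0 ≤ t → Measure.sum (fun n => occLaw P I S lam π n t) = π := by
    intro t ht
    ext A hA
    rw [← h.lintegral_workload hlam ht hA, hπ.invariant t ht A hA]
  refine Measure.eq_of_le_of_isProbabilityMeasure (Measure.le_iff.2 fun A hA => ?_)
  let f : ℝ → ℝ≥0∞ := A.indicator 1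
  have hf : Measurable f := measurable_one.indicator hA
  have hf1 : ∀ y, f y ≤ 1 := fun y => indicator_le_self' (fun _ _ => zero_le) y
  have hbound : ∀ t, 0 ≤ t →
      π A ≤ ENNReal.ofReal (Real.exp (-(lam * t))) + stepLaw lam G π A := by
    intro t ht
    have hzero : ∫⁻ x, f (max (x - t) 0) ∂π ≤ 1 := by
      calc _ ≤ ∫⁻ _, 1 ∂π := lintegral_mono fun y => hf1 _
        _ = 1 := by simp
    rw [← lintegral_indicator_one hA, ← lintegral_indicator_one hA,
      lintegral_stepLaw hf]
    change ∫⁻ y, f y ∂π ≤ _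
    conv_lhs => rw [← hsum t ht]
    rw [lintegral_sum_measure, tsum_eq_zero_add' ENNReal.summable,
      lintegral_occLaw_zero ht hf]
    refine add_le_add ((mul_le_mul_right hzero _).trans_eq (mul_one _)) ?_
    simp_rw [fun n => h.lintegral_occLaw_succ (π := π) hlam n t hf]
    rw [← lintegral_tsum fun n => (measurable_occLaw_integrand n t hf).aemeasurable]
    refine (setLIntegral_mono' measurableSet_Icc fun v hv => ?_).trans
      (lintegral_mono_set Icc_subset_Ici_self)
    rw [ENNReal.tsum_mul_left, ← lintegral_sum_measure, hsum (t - v) (sub_nonneg.2 hv.2)]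
  have hlim : Filter.Tendsto (fun t : ℝ => ENNReal.ofReal (Real.exp (-(lam * t))) +
      stepLaw lam G π A) Filter.atTop (nhds (0 + stepLaw lam G π A)) := by
    refine Filter.Tendsto.add ?_ tendsto_const_nhds
    rw [← ENNReal.ofReal_zero]
    refine ENNReal.tendsto_ofReal (Real.tendsto_exp_atBot.comp ?_)
    exact Filter.tendsto_neg_atTop_atBot.comp (Filter.tendsto_id.const_mul_atTop hlam)
  rw [zero_add] at hlim
  exact ge_of_tendsto hlim (Filter.eventually_atTop.2 ⟨0, hbound⟩)

/-- A fixed point satisfies, by `lintegral_stepLaw_split`, the equation obtained by summing the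
recursion for `occLaw`. Induction on the number of arrivals bounds the partial sums by `π`, and
equality follows since both total masses are 1. -/
lemma isInvariant_of_eq_stepLaw (h : IsMG1Input P lam G I S) (hlam : 0 < lam)
    [IsProbabilityMeasure π] (hneg : π (Iio 0) = 0) (hπ : π = stepLaw lam G π) :
    IsInvariant P I S π := by
  refine ⟨inferInstance, hneg, fun t ht A hA => ?_⟩
  rw [h.lintegral_workload hlam ht hA]
  -- All `t` and `f` are needed at once: the induction step uses time `t - v` and the function
  -- `afterArrival G v f`.
  suffices hle : ∀ (N : ℕ) (t : ℝ), 0 ≤ t → ∀ f : ℝ → ℝ≥0∞, Measurable f →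
      ∑ n ∈ Finset.range N, ∫⁻ y, f y ∂(occLaw P I S lam π n t) ≤ ∫⁻ y, f y ∂π by
    have : IsProbabilityMeasure (Measure.sum fun n => occLaw P I S lam π n t) :=
      ⟨by rw [Measure.sum_apply _ MeasurableSet.univ, h.tsum_occLaw_univ hlam ht]⟩
    have heq : (Measure.sum fun n => occLaw P I S lam π n t) = π := by
      refine Measure.eq_of_le_of_isProbabilityMeasure (Measure.le_iff.2 fun B hB => ?_)
      rw [Measure.sum_apply _ hB]
      refine ENNReal.tsum_le_of_sum_range_le fun N => ?_
      simpa [lintegral_indicator_one hB] using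
        hle N t ht (B.indicator 1) (measurable_one.indicator hB)
    rw [heq]
  intro N
  induction N with
  | zero => simp
  | succ N ih =>
    intro t ht f hf
    have hk : Measurable fun p : ℝ × ℝ => afterArrival G p.1 f p.2 :=
      measurable_afterArrival hf measurable_fst measurable_snd
    have hsplit := lintegral_stepLaw_split (lam := lam) (G := G) (π := π) ht hf
    rw [← hπ] at hsplit
    rw [Finset.sum_range_succ', add_comm, lintegral_occLaw_zero ht hf, hsplit]
    refine add_le_add le_rfl ?_
    simp_rw [fun n => h.lintegral_occLaw_succ (π := π) hlam n t hf]
    rw [← lintegral_finsetSum _ fun n _ => measurable_occLaw_integrand n t hf]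
    refine setLIntegral_mono' measurableSet_Icc fun v hv => ?_
    rw [← Finset.mul_sum]
    exact mul_le_mul_right (ih (t - v) (sub_nonneg.2 hv.2) _ (hk.comp measurable_prodMk_left)) _

end IsMG1Input
end Invariance

/-! ### The level crossing identity -/

section LevelCrossing

/-- Two finite measures on `ℝ` of equal mass agree if they agree on the half-lines `(y, ∞)`. -/
lemma measure_ext_of_Ioi {μ ν : Measure ℝ} [IsFiniteMeasure μ] (huniv : μ univ = ν univ)
    (h : ∀ y, μ (Ioi y) = ν (Ioi y)) : μ = ν := by
  refine ext_of_generate_finite (range Ioi) ?_ isPiSystem_Ioi ?_ huniv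
  · rw [← borel_eq_generateFrom_Ioi]; exact BorelSpace.measurable_eq
  · rintro _ ⟨y, rfl⟩
    exact h y

/-- For workload of law `π`, the probability that an arriving customer is admitted and lifts the
workload from at most `z` to above `z`. -/
noncomputable def upcrossing (G π : Measure ℝ) (z : ℝ) : ℝ≥0∞ :=
  ∫⁻ x in Iio 1, (Iic z).indicator (fun x => G (Ioi (z - x))) x ∂π

variable {lam : ℝ} {G π : Measure ℝ}

lemma measurable_tail_measure (G : Measure ℝ) : Measurable fun z => G (Ioi z) :=
  Antitone.measurable fun _ _ h => measure_mono (Ioi_subset_Ioi h)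

lemma measurable_upcrossing_integrand (G : Measure ℝ) : Measurable fun p : ℝ × ℝ =>
    (Iic p.1).indicator (fun x => G (Ioi (p.1 - x))) p.2 :=
  (((measurable_tail_measure G).comp (measurable_fst.sub measurable_snd))).indicator
    (s := {p : ℝ × ℝ | p.2 ∈ Iic p.1}) (measurableSet_le measurable_snd measurable_fst)

@[fun_prop]
lemma measurable_upcrossing [SFinite π] : Measurable (upcrossing G π) :=
  (measurable_upcrossing_integrand G).lintegral_prod_right'

lemma upcrossing_le_one [IsProbabilityMeasure G] [IsProbabilityMeasure π] (z : ℝ) :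
    upcrossing G π z ≤ 1 := by
  calc upcrossing G π z ≤ ∫⁻ _ in Iio 1, 1 ∂π :=
        lintegral_mono fun x => (indicator_le_self' (fun _ _ => zero_le) x).trans prob_le_one
    _ ≤ 1 := by simpa using prob_le_one

/-- The part of the exponential density shifted by `y`. -/
noncomputable def shiftedDensity (lam y z : ℝ) : ℝ≥0∞ :=
  (Ici y).indicator (fun z => ENNReal.ofReal (lam * Real.exp (-(lam * (z - y))))) z

@[fun_prop]
lemma measurable_shiftedDensity (lam y : ℝ) : Measurable (shiftedDensity lam y) :=
  Measurable.indicator (by fun_prop) measurableSet_Ici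

/-- The density is based at `y` so that `c` enters only through the domain; raising `c` from `x` to
`x + s` then adds the integral over the levels in `[x, x + s)`. -/
lemma expMeasure_Iio (lam c y : ℝ) :
    expMeasure lam (Iio (c - y)) = ∫⁻ z in Iio c, shiftedDensity lam y z := by
  rw [← lintegral_indicator_one measurableSet_Iio,
    lintegral_expMeasure lam (measurable_one.indicator measurableSet_Iio),
    ← lintegral_indicator measurableSet_Ici, ← lintegral_indicator measurableSet_Iio,
    ← lintegral_sub_right_eq_self _ y]
  refine lintegral_congr fun z => ?_
  by_cases h1 : y ≤ z <;> by_cases h2 : z < c <;>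
    simp [shiftedDensity, Set.indicator, h1, h2]

lemma expMeasure_Ici {c : ℝ} (hlam : 0 < lam) (hc : 0 ≤ c) :
    expMeasure lam (Ici c) = ENNReal.ofReal (Real.exp (-(lam * c))) := by
  rw [← expMeasure_Ioi hlam hc]
  have : expMeasure lam ≪ volume := withDensity_absolutelyContinuous _ _
  exact measure_congr (this.ae_eq (Ioi_ae_eq_Ici (a := c))).symm

lemma expMeasure_Iio_of_nonpos {c : ℝ} (hc : c ≤ 0) : expMeasure lam (Iio c) = 0 := by
  have := expMeasure_Iio lam c 0
  rw [sub_zero] at this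
  rw [this, setLIntegral_congr_fun (g := fun _ => 0) measurableSet_Iio, lintegral_zero]
  intro z hz
  exact indicator_of_notMem (fun h : 0 ≤ z => not_lt.2 (hc.trans h) hz) _

/-- The first term is the one that also occurs in `stepLaw_Ioi`, so that it cancels in the
comparison of tails. -/
lemma measure_Ioi_eq_add [SFinite π] (hlam : 0 < lam) (y : ℝ) :
    π (Ioi y) = ∫⁻ x, expMeasure lam (Iio (x - y)) ∂π +
      ∫⁻ x in Ioi y, ENNReal.ofReal (Real.exp (-(lam * (x - y)))) ∂π := by
  have := isProbabilityMeasure_expMeasure hlam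
  rw [← lintegral_indicator_one measurableSet_Ioi, ← lintegral_indicator measurableSet_Ioi,
    ← lintegral_add_right _ (Measurable.indicator (by fun_prop) measurableSet_Ioi)]
  refine lintegral_congr fun x => ?_
  by_cases hx : y < x
  · rw [indicator_of_mem (show x ∈ Ioi y from hx), indicator_of_mem (show x ∈ Ioi y from hx),
      ← expMeasure_Ici hlam (sub_nonneg.2 hx.le), ← compl_Iio,
      prob_add_prob_compl measurableSet_Iio, Pi.one_apply]
  · rw [indicator_of_notMem (show x ∉ Ioi y from hx), indicator_of_notMem (show x ∉ Ioi y from hx),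
      expMeasure_Iio_of_nonpos (by linarith), add_zero]

/-- The first term is the value without the arriving customer. An admitted service requirement `s`
adds the integral of the shifted density over the levels `z` in `[x, x + s)`; by Tonelli, each level
is weighted by the probability that it is upcrossed. -/
lemma stepLaw_Ioi [IsProbabilityMeasure G] [SFinite π] (hlam : 0 < lam) (hG : G (Iio 0) = 0)
    {y : ℝ} (hy : 0 ≤ y) :
    stepLaw lam G π (Ioi y) = ∫⁻ x, expMeasure lam (Iio (x - y)) ∂π +
      ∫⁻ z, shiftedDensity lam y z * upcrossing G π z := by
  have := isProbabilityMeasure_expMeasure hlam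
  have hGae : ∀ᵐ s ∂G, 0 ≤ s := by
    filter_upwards [measure_eq_zero_iff_ae_notMem.1 hG] with s hs
    exact not_lt.1 hs
  have hg : Measurable fun c => expMeasure lam (Iio (c - y)) :=
    Monotone.measurable fun a b h => measure_mono (Iio_subset_Iio (by linarith))
  have h1 : stepLaw lam G π (Ioi y) =
      ∫⁻ x, ∫⁻ s, expMeasure lam (Iio (accept x s - y)) ∂G ∂π := by
    rw [stepLaw, Measure.map_apply measurable_step measurableSet_Ioi,
      Measure.prod_apply_symm (measurable_step measurableSet_Ioi),
      lintegral_prod _ (measurable_measure_prodMk_right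
        (measurable_step measurableSet_Ioi)).aemeasurable]
    refine lintegral_congr fun x => lintegral_congr fun s => ?_
    congr 1
    ext v
    simp only [mem_preimage, mem_Ioi, mem_Iio, lt_max_iff, not_lt.2 hy, or_false]
    constructor <;> intro h <;> linarith
  have h2 : ∀ x, ∫⁻ s, expMeasure lam (Iio (accept x s - y)) ∂G =
      expMeasure lam (Iio (x - y)) + (Iio 1).indicator (fun x => ∫⁻ z, shiftedDensity lam y z *
        (Iic z).indicator (fun x => G (Ioi (z - x))) x) x := by
    intro x
    by_cases hx : x < 1
    · rw [indicator_of_mem (show x ∈ Iio 1 from hx)]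
      have h3 : ∀ᵐ s ∂G, expMeasure lam (Iio (accept x s - y)) =
          expMeasure lam (Iio (x - y)) + ∫⁻ z, (Ico x (x + s)).indicator
            (shiftedDensity lam y) z := by
        filter_upwards [hGae] with s hs
        rw [expMeasure_Iio, expMeasure_Iio, accept, if_pos hx,
          lintegral_indicator measurableSet_Ico,
          ← Iio_union_Ico_eq_Iio (le_add_of_nonneg_right hs),
          lintegral_union measurableSet_Ico (by
            rw [Set.disjoint_left]; exact fun z hz hz' => not_lt.2 hz'.1 hz)]
      have hm : Measurable fun p : ℝ × ℝ =>
          (Ico x (x + p.1)).indicator (shiftedDensity lam y) p.2 := by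
        have h4 : Measurable fun p : ℝ × ℝ => shiftedDensity lam y p.2 := by fun_prop
        exact h4.indicator (s := {p : ℝ × ℝ | p.2 ∈ Ico x (x + p.1)})
          ((measurableSet_le measurable_const measurable_snd).inter
            (measurableSet_lt measurable_snd (by fun_prop)))
      rw [lintegral_congr_ae h3, lintegral_add_left measurable_const, lintegral_const,
        measure_univ, mul_one, lintegral_lintegral_swap hm.aemeasurable]
      congr 1
      refine lintegral_congr fun z => ?_
      have h5 : ∀ s, (Ico x (x + s)).indicator (shiftedDensity lam y) z =
          (Ioi (z - x)).indicator (fun _ => shiftedDensity lam y z *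
            (Iic z).indicator 1 x) s := by
        intro s
        by_cases h6 : x ≤ z <;> by_cases h7 : z < x + s <;>
          simp [Set.indicator, h6, h7, sub_lt_iff_lt_add']
      simp_rw [h5]
      rw [lintegral_indicator_const measurableSet_Ioi]
      by_cases h6 : x ≤ z <;> simp [Set.indicator, h6]
    · rw [indicator_of_notMem (show x ∉ Iio 1 from hx)]
      simp [accept, hx]
  rw [h1]
  simp_rw [h2]
  rw [lintegral_add_left hg, lintegral_indicator measurableSet_Iio]
  congr 1
  have hm : Measurable fun p : ℝ × ℝ => shiftedDensity lam y p.2 *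
      (Iic p.2).indicator (fun x => G (Ioi (p.2 - x))) p.1 := by
    have := (measurable_upcrossing_integrand G).comp measurable_swap
    exact Measurable.mul (by fun_prop) this
  rw [lintegral_lintegral_swap hm.aemeasurable]
  refine lintegral_congr fun z => ?_
  exact lintegral_const_mul _
    ((measurable_upcrossing_integrand G).comp measurable_prodMk_left)

lemma measure_Ioi_eq_stepLaw_Ioi_iff [IsProbabilityMeasure G] [IsProbabilityMeasure π]
    (hlam : 0 < lam) (hG : G (Iio 0) = 0) {y : ℝ} (hy : 0 ≤ y) :
    π (Ioi y) = stepLaw lam G π (Ioi y) ↔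
      ∫⁻ x in Ioi y, ENNReal.ofReal (Real.exp (-(lam * x))) ∂π =
        ∫⁻ z in Ioi y, ENNReal.ofReal (Real.exp (-(lam * z))) *
          (ENNReal.ofReal lam * upcrossing G π z) := by
  have := isProbabilityMeasure_expMeasure hlam
  have hfin : ∫⁻ x, expMeasure lam (Iio (x - y)) ∂π ≠ ∞ := by
    refine ne_top_of_le_ne_top (b := 1) ENNReal.one_ne_top ?_
    calc _ ≤ ∫⁻ _, 1 ∂π := lintegral_mono fun x => prob_le_one
      _ = 1 := by simp
  have h1 : ∀ x, ENNReal.ofReal (Real.exp (-(lam * (x - y)))) =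
      ENNReal.ofReal (Real.exp (lam * y)) * ENNReal.ofReal (Real.exp (-(lam * x))) := by
    intro x
    rw [← ENNReal.ofReal_mul (by positivity), ← Real.exp_add]
    ring_nf
  have h2 : ∫⁻ z, shiftedDensity lam y z * upcrossing G π z =
      ENNReal.ofReal (Real.exp (lam * y)) *
        ∫⁻ z in Ioi y, ENNReal.ofReal (Real.exp (-(lam * z))) *
          (ENNReal.ofReal lam * upcrossing G π z) := by
    rw [setLIntegral_congr Ioi_ae_eq_Ici, ← lintegral_const_mul _ (by fun_prop),
      ← lintegral_indicator measurableSet_Ici]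
    refine lintegral_congr fun z => ?_
    by_cases hz : z ∈ Ici y
    · rw [shiftedDensity, indicator_of_mem hz, indicator_of_mem hz,
        ENNReal.ofReal_mul hlam.le, h1]
      ring
    · rw [shiftedDensity, indicator_of_notMem hz, indicator_of_notMem hz, zero_mul]
  rw [stepLaw_Ioi hlam hG hy, measure_Ioi_eq_add hlam y, ENNReal.add_right_inj hfin, h2]
  simp_rw [h1]
  rw [lintegral_const_mul _ (by fun_prop)]
  exact ENNReal.mul_right_inj (by simpa using Real.exp_pos _) ENNReal.ofReal_ne_top

/-- The level crossing identity: at the stationary distribution the density at `z > 0`, the rate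
of downcrossings of `z`, is the rate of upcrossings. -/
def LevelCrossing (lam : ℝ) (G π : Measure ℝ) : Prop :=
  π.restrict (Ioi 0) =
    (volume.restrict (Ioi 0)).withDensity fun z => ENNReal.ofReal lam * upcrossing G π z

/-- By `measure_Ioi_eq_stepLaw_Ioi_iff`, equality of the tails at `y ≥ 0` says that the two sides of
the level crossing identity, weighted by `e^(-λx)`, give `(y, ∞)` the same mass. Tails determine the
weighted measures, and the positive weight can be divided out. -/
lemma eq_stepLaw_iff_levelCrossing [IsProbabilityMeasure G] [IsProbabilityMeasure π]
    (hlam : 0 < lam) (hG : G (Iio 0) = 0) (hπ : π (Iio 0) = 0) :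
    π = stepLaw lam G π ↔ LevelCrossing lam G π := by
  have := isProbabilityMeasure_stepLaw (G := G) (π := π) hlam
  set E : ℝ → ℝ≥0∞ := fun x => ENNReal.ofReal (Real.exp (-(lam * x))) with hE
  have hEm : Measurable E := by fun_prop
  have hcm : Measurable fun z => ENNReal.ofReal lam * upcrossing G π z := by fun_prop
  constructor
  · intro h
    have h1 : ∀ y, 0 ≤ y → ∫⁻ x in Ioi y, E x ∂π =
        ∫⁻ z in Ioi y, E z * (ENNReal.ofReal lam * upcrossing G π z) := fun y hy =>
      (measure_Ioi_eq_stepLaw_Ioi_iff hlam hG hy).1 (congrArg (fun μ => μ (Ioi y)) h)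
    have hL : ∀ y, (π.restrict (Ioi 0)).withDensity E (Ioi y) =
        ∫⁻ x in Ioi (max y 0), E x ∂π := by
      intro y
      rw [withDensity_apply _ measurableSet_Ioi, Measure.restrict_restrict measurableSet_Ioi,
        Ioi_inter_Ioi]
    have hR : ∀ y, ((volume.restrict (Ioi 0)).withDensity
        fun z => ENNReal.ofReal lam * upcrossing G π z).withDensity E (Ioi y) =
        ∫⁻ z in Ioi (max y 0), E z * (ENNReal.ofReal lam * upcrossing G π z) := by
      intro y
      rw [withDensity_apply _ measurableSet_Ioi, restrict_withDensity measurableSet_Ioi,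
        Measure.restrict_restrict measurableSet_Ioi, Ioi_inter_Ioi,
        lintegral_withDensity_eq_lintegral_mul _ hcm hEm]
      exact lintegral_congr fun z => mul_comm _ _
    have hcompl : ∀ μ : Measure ℝ, μ (Iic 0) = 0 → μ univ = μ (Ioi 0) := by
      intro μ hμ
      rw [← compl_Iic, measure_compl measurableSet_Iic (by simp [hμ]), hμ, tsub_zero]
    have hac : ∀ (μ : Measure ℝ), ((μ.restrict (Ioi 0)).withDensity E) (Iic 0) = 0 := by
      intro μ
      refine withDensity_absolutelyContinuous _ _ ?_
      rw [Measure.restrict_apply measurableSet_Iic, inter_comm, Ioi_inter_Iic, Ioc_self,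
        measure_empty]
    have hfin : IsFiniteMeasure ((π.restrict (Ioi 0)).withDensity E) := by
      refine isFiniteMeasure_withDensity (ne_top_of_le_ne_top (b := 1) ENNReal.one_ne_top ?_)
      calc _ ≤ ∫⁻ _ in Ioi 0, 1 ∂π := setLIntegral_mono measurable_const fun x hx => by
            have : (0 : ℝ) < x := hx
            rw [hE, ENNReal.ofReal_le_one]
            exact Real.exp_le_one_iff.2 (by nlinarith)
        _ ≤ 1 := by simpa using prob_le_one
    have h2 : ∀ y, (π.restrict (Ioi 0)).withDensity E (Ioi y) =
        ((volume.restrict (Ioi 0)).withDensity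
        fun z => ENNReal.ofReal lam * upcrossing G π z).withDensity E (Ioi y) := fun y => by
      rw [hL, hR, h1 _ (le_max_right _ _)]
    have h3 := measure_ext_of_Ioi (by
      rw [hcompl _ (hac π), hcompl _ ?_, h2 0]
      refine withDensity_absolutelyContinuous _ _ (withDensity_absolutelyContinuous _ _ ?_)
      rw [Measure.restrict_apply measurableSet_Iic, inter_comm, Ioi_inter_Iic, Ioc_self,
        measure_empty]) h2
    have hE0 : ∀ μ : Measure ℝ, ∀ᵐ x ∂μ, E x ≠ 0 := fun μ => .of_forall fun x => by
      simpa [hE] using Real.exp_pos _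
    have hE1 : ∀ μ : Measure ℝ, ∀ᵐ x ∂μ, E x ≠ ∞ := fun μ => .of_forall fun x =>
      ENNReal.ofReal_ne_top
    have h4 := congrArg (fun μ : Measure ℝ => μ.withDensity fun x => (E x)⁻¹) h3
    rwa [withDensity_inv_same hEm (hE0 _) (hE1 _), withDensity_inv_same hEm (hE0 _) (hE1 _)] at h4
  · intro h
    have h0 : ∀ y, 0 ≤ y → π (Ioi y) = stepLaw lam G π (Ioi y) := by
      intro y hy
      rw [measure_Ioi_eq_stepLaw_Ioi_iff hlam hG hy]
      have h1 : π.restrict (Ioi y) = (π.restrict (Ioi 0)).restrict (Ioi y) := by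
        rw [Measure.restrict_restrict measurableSet_Ioi, Ioi_inter_Ioi, max_eq_left hy]
      rw [h1, h, restrict_withDensity measurableSet_Ioi,
        Measure.restrict_restrict measurableSet_Ioi, Ioi_inter_Ioi, max_eq_left hy,
        lintegral_withDensity_eq_lintegral_mul _ hcm hEm]
      exact lintegral_congr fun z => mul_comm _ _
    refine measure_ext_of_Ioi (by simp) fun y => ?_
    rcases le_or_gt 0 y with hy | hy
    · exact h0 y hy
    · have h1 : π (Ioi y) = 1 := by
        refine (prob_compl_eq_zero_iff measurableSet_Ioi).1 (measure_mono_null (fun x hx => ?_) hπ)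
        have : x ≤ y := not_lt.1 hx
        exact this.trans_lt hy
      have h2 : stepLaw lam G π (Ioi y) = 1 := by
        rw [stepLaw, Measure.map_apply measurable_step measurableSet_Ioi]
        have := isProbabilityMeasure_expMeasure hlam
        have : (fun p : ℝ × ℝ × ℝ => max (accept p.2.1 p.2.2 - p.1) 0) ⁻¹' Ioi y = univ :=
          eq_univ_of_forall fun p => hy.trans_le (le_max_right _ _)
        rw [this, measure_univ]
      rw [h1, h2]

end LevelCrossing

/-! ### The renewal series and the Volterra equation -/

section Renewal

variable {lam : ℝ} {G : Measure ℝ}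

lemma tail_nonneg (x : ℝ) : 0 ≤ tail G x := measureReal_nonneg

@[fun_prop]
lemma measurable_tail : Measurable (tail G) :=
  (measurable_tail_measure G).ennreal_toReal

lemma measurable_tailConv (i : ℕ) : Measurable (tailConv G i) := by
  induction i with
  | zero => exact measurable_tail
  | succ i ih =>
    have h1 : Measurable fun p : ℝ × ℝ => tail G (p.1 - p.2) * tailConv G i p.2 := by fun_prop
    have hf : MeasurableSet {p : ℝ × ℝ | p.2 ∈ Ioc 0 p.1} :=
      (measurableSet_lt measurable_const measurable_snd).inter
        (measurableSet_le measurable_snd measurable_fst)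
    have hb : MeasurableSet {p : ℝ × ℝ | p.2 ∈ Ioc p.1 0} :=
      (measurableSet_lt measurable_fst measurable_snd).inter
        (measurableSet_le measurable_snd measurable_const)
    -- The interval integral is signed: the second term accounts for negative `x`.
    have h2 : tailConv G (i + 1) = fun x =>
        (∫ y, (Ioc 0 x).indicator (fun y => tail G (x - y) * tailConv G i y) y) -
          ∫ y, (Ioc x 0).indicator (fun y => tail G (x - y) * tailConv G i y) y := by
      ext x
      rw [integral_indicator measurableSet_Ioc, integral_indicator measurableSet_Ioc]
      rfl
    rw [h2]
    exact ((h1.indicator hf).stronglyMeasurable.integral_prod_right'.measurable).sub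
      ((h1.indicator hb).stronglyMeasurable.integral_prod_right'.measurable)

/-- The sum of the convolution powers of `lam * tail G`. -/
noncomputable def renewal (lam : ℝ) (G : Measure ℝ) (x : ℝ) : ℝ :=
  ∑' i : ℕ, lam ^ (i + 1) * tailConv G i x

@[fun_prop]
lemma measurable_renewal : Measurable (renewal lam G) :=
  Measurable.tsum fun i => (measurable_tailConv i).const_mul _

lemma integral_id_nonneg (hG : G (Iio 0) = 0) : 0 ≤ ∫ s, s ∂G := by
  refine integral_nonneg_of_ae ?_
  filter_upwards [measure_eq_zero_iff_ae_notMem.1 hG] with s hs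
  exact not_lt.1 hs

variable [IsProbabilityMeasure G]

lemma tail_le_one (x : ℝ) : tail G x ≤ 1 := measureReal_le_one

lemma ofReal_tail (x : ℝ) : ENNReal.ofReal (tail G x) = G (Ioi x) := ofReal_measureReal

lemma intervalIntegrable_of_bound {g : ℝ → ℝ} (hg : Measurable g) {b C : ℝ} (hb : 0 ≤ b)
    (hC : ∀ y ∈ Ioc 0 b, |g y| ≤ C) : IntervalIntegrable g volume 0 b := by
  refine (intervalIntegrable_iff_integrableOn_Ioc_of_le hb).2
    (Measure.integrableOn_of_bounded (M := C) (by simp) hg.aestronglyMeasurable ?_)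
  exact (ae_restrict_iff' measurableSet_Ioc).2 (.of_forall hC)

/-- As the tail is at most 1, its convolution powers are dominated by those of the constant 1. The
factorial makes every series converge for all `λ`, with no stability condition on `λ E(S)`. -/
lemma tailConv_bounds (i : ℕ) {x : ℝ} (hx : 0 ≤ x) :
    0 ≤ tailConv G i x ∧ tailConv G i x ≤ x ^ i / i.factorial := by
  induction i generalizing x with
  | zero => simpa [tailConv] using And.intro (tail_nonneg (G := G) x) (tail_le_one (G := G) x)
  | succ i ih =>
    have hbound : ∀ y ∈ Icc 0 x, tail G (x - y) * tailConv G i y ≤ y ^ i / i.factorial := by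
      intro y hy
      have := mul_le_mul (tail_le_one (G := G) (x - y)) (ih hy.1).2 (ih hy.1).1 zero_le_one
      rwa [one_mul] at this
    have hnn : ∀ y ∈ Icc 0 x, 0 ≤ tail G (x - y) * tailConv G i y := fun y hy =>
      mul_nonneg (tail_nonneg _) (ih hy.1).1
    refine ⟨intervalIntegral.integral_nonneg hx hnn, ?_⟩
    have hint : IntervalIntegrable (fun y => tail G (x - y) * tailConv G i y) volume 0 x := by
      have := measurable_tailConv (G := G) i
      refine intervalIntegrable_of_bound (by fun_prop) (C := x ^ i / i.factorial) hx
        fun y hy => ?_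
      have hy' : y ∈ Icc 0 x := Ioc_subset_Icc_self hy
      rw [abs_of_nonneg (hnn y hy')]
      refine (hbound y hy').trans ?_
      have := hy'.1
      have := hy'.2
      gcongr
    calc tailConv G (i + 1) x ≤ ∫ y in (0 : ℝ)..x, y ^ i / i.factorial :=
          intervalIntegral.integral_mono_on hx hint
            (Continuous.intervalIntegrable (by fun_prop) _ _) hbound
      _ = x ^ (i + 1) / (i + 1).factorial := by
          rw [intervalIntegral.integral_div, integral_pow, Nat.factorial_succ]
          push_cast
          rw [zero_pow (Nat.succ_ne_zero i), sub_zero, div_div]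

lemma summable_exp_bound (lam b : ℝ) :
    Summable fun i : ℕ => lam ^ (i + 1) * (b ^ i / i.factorial) := by
  refine ((Real.summable_pow_div_factorial (lam * b)).mul_left lam).congr fun i => ?_
  rw [pow_succ, mul_pow]
  ring

lemma summable_renewal (hlam : 0 < lam) {x : ℝ} (hx : 0 ≤ x) :
    Summable fun i : ℕ => lam ^ (i + 1) * tailConv G i x :=
  Summable.of_nonneg_of_le (fun i => mul_nonneg (by positivity) (tailConv_bounds i hx).1)
    (fun i => mul_le_mul_of_nonneg_left (tailConv_bounds i hx).2 (by positivity))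
    (summable_exp_bound lam x)

lemma renewal_nonneg (hlam : 0 < lam) {x : ℝ} (hx : 0 ≤ x) : 0 ≤ renewal lam G x :=
  tsum_nonneg fun i => mul_nonneg (by positivity) (tailConv_bounds i hx).1

/-- A bound for `renewal lam G` on `[0, b]`. -/
noncomputable def renewalBound (lam b : ℝ) : ℝ :=
  ∑' i : ℕ, lam ^ (i + 1) * (b ^ i / i.factorial)

lemma renewal_le (hlam : 0 < lam) {x b : ℝ} (hx : 0 ≤ x) (hxb : x ≤ b) :
    renewal lam G x ≤ renewalBound lam b :=
  (summable_renewal hlam hx).tsum_le_tsum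
    (fun i => mul_le_mul_of_nonneg_left ((tailConv_bounds i hx).2.trans (by gcongr))
      (by positivity)) (summable_exp_bound lam b)

/-- Dominated convergence with the bound `tailConv_bounds`. The case `k = 1` serves the normalizer,
the case `k y = tail G (z - y)` the density and the renewal equation. -/
lemma hasSum_integral_renewal (hlam : 0 < lam) {k : ℝ → ℝ} (hk : Measurable k)
    (hk1 : ∀ y, |k y| ≤ 1) {b : ℝ} (hb : 0 ≤ b) :
    HasSum (fun i : ℕ => lam ^ (i + 1) * ∫ y in (0 : ℝ)..b, k y * tailConv G i y)
      (∫ y in (0 : ℝ)..b, k y * renewal lam G y) := by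
  have h := intervalIntegral.hasSum_integral_of_dominated_convergence (μ := volume)
    (a := 0) (b := b) (F := fun (i : ℕ) y => lam ^ (i + 1) * (k y * tailConv G i y))
    (f := fun y => k y * renewal lam G y)
    (fun i _ => lam ^ (i + 1) * (b ^ i / i.factorial)) ?_ ?_ ?_ ?_ ?_
  · simpa only [intervalIntegral.integral_const_mul] using h
  · intro i
    have := measurable_tailConv (G := G) i
    exact Measurable.aestronglyMeasurable (by fun_prop)
  · refine fun i => .of_forall fun y hy => ?_
    rw [uIoc_of_le hb] at hy
    have h1 := tailConv_bounds (G := G) i hy.1.le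
    rw [Real.norm_eq_abs, abs_mul, abs_of_pos (by positivity : 0 < lam ^ (i + 1)), abs_mul,
      abs_of_nonneg h1.1]
    refine mul_le_mul_of_nonneg_left ?_ (by positivity)
    have h2 : tailConv G i y ≤ b ^ i / i.factorial :=
      h1.2.trans (by have := hy.1.le; have := hy.2; gcongr)
    calc |k y| * tailConv G i y ≤ 1 * tailConv G i y :=
          mul_le_mul_of_nonneg_right (hk1 y) h1.1
      _ ≤ _ := by rwa [one_mul]
  · exact .of_forall fun y _ => summable_exp_bound lam b
  · exact intervalIntegrable_const
  · refine .of_forall fun y hy => ?_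
    rw [uIoc_of_le hb] at hy
    have h1 : (fun i => lam ^ (i + 1) * (k y * tailConv G i y)) =
        fun i => k y * (lam ^ (i + 1) * tailConv G i y) := funext fun i => mul_left_comm _ _ _
    rw [h1]
    exact ((summable_renewal (G := G) hlam hy.1.le).hasSum).mul_left (k y)

lemma hasSum_integral_tail_renewal (hlam : 0 < lam) (z : ℝ) {b : ℝ} (hb : 0 ≤ b) :
    HasSum (fun i : ℕ => lam ^ (i + 1) * ∫ y in (0 : ℝ)..b, tail G (z - y) * tailConv G i y)
      (∫ y in (0 : ℝ)..b, tail G (z - y) * renewal lam G y) :=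
  hasSum_integral_renewal hlam (by fun_prop)
    (fun y => by rw [abs_of_nonneg (tail_nonneg _)]; exact tail_le_one _) hb

lemma hasSum_integral_tailConv (hlam : 0 < lam) {b : ℝ} (hb : 0 ≤ b) :
    HasSum (fun i : ℕ => lam ^ (i + 1) * ∫ y in (0 : ℝ)..b, tailConv G i y)
      (∫ y in (0 : ℝ)..b, renewal lam G y) := by
  simpa using hasSum_integral_renewal (G := G) hlam (k := fun _ => 1) measurable_const
    (by simp) hb

/-- The renewal equation. -/
lemma renewal_eq (hlam : 0 < lam) {z : ℝ} (hz : 0 ≤ z) :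
    renewal lam G z =
      lam * (tail G z + ∫ y in (0 : ℝ)..z, tail G (z - y) * renewal lam G y) := by
  rw [renewal, (summable_renewal hlam hz).tsum_eq_zero_add,
    ← (hasSum_integral_tail_renewal hlam z hz).tsum_eq, mul_add, ← tsum_mul_left]
  congr 1
  · simp [tailConv]
  · refine tsum_congr fun i => ?_
    rw [pow_succ' lam (i + 1), mul_assoc]
    rfl

lemma intervalIntegrable_tail_mul {g : ℝ → ℝ} (hg : Measurable g) {b C : ℝ} (hb : 0 ≤ b)
    (hC : ∀ y ∈ Ioc 0 b, |g y| ≤ C) (z : ℝ) :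
    IntervalIntegrable (fun y => tail G (z - y) * g y) volume 0 b := by
  refine intervalIntegrable_of_bound (C := C) (by fun_prop) hb fun y hy => ?_
  rw [abs_mul, abs_of_nonneg (tail_nonneg _)]
  calc tail G (z - y) * |g y| ≤ 1 * |g y| :=
        mul_le_mul_of_nonneg_right (tail_le_one _) (abs_nonneg _)
    _ ≤ C := by rw [one_mul]; exact hC y hy

/-- A bounded solution of the homogeneous Volterra equation vanishes. -/
lemma eq_zero_of_volterra (hlam : 0 < lam) {d : ℝ → ℝ} {b C : ℝ}
    (hC : ∀ y ∈ Ioc 0 b, |d y| ≤ C)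
    (hd : ∀ z ∈ Ioc 0 b, d z = lam * ∫ y in (0 : ℝ)..z, tail G (z - y) * d y) :
    ∀ z ∈ Ioc 0 b, d z = 0 := by
  have key : ∀ (n : ℕ), ∀ z ∈ Ioc 0 b, |d z| ≤ C * ((lam * z) ^ n / n.factorial) := by
    intro n
    induction n with
    | zero => simpa using hC
    | succ n ih =>
      intro z hz
      have h1 : ‖∫ y in (0 : ℝ)..z, tail G (z - y) * d y‖ ≤
          ∫ y in (0 : ℝ)..z, C * ((lam * y) ^ n / n.factorial) := by
        refine intervalIntegral.norm_integral_le_of_norm_le hz.1.le (.of_forall fun y hy => ?_)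
          (Continuous.intervalIntegrable (by fun_prop) _ _)
        rw [Real.norm_eq_abs, abs_mul, abs_of_nonneg (tail_nonneg _)]
        calc tail G (z - y) * |d y| ≤ 1 * |d y| :=
              mul_le_mul_of_nonneg_right (tail_le_one _) (abs_nonneg _)
          _ ≤ _ := by rw [one_mul]; exact ih y ⟨hy.1, hy.2.trans hz.2⟩
      rw [hd z hz, abs_mul, abs_of_pos hlam]
      refine (mul_le_mul_of_nonneg_left h1 hlam.le).trans_eq ?_
      simp_rw [mul_pow]
      rw [intervalIntegral.integral_const_mul, intervalIntegral.integral_div,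
        intervalIntegral.integral_const_mul, integral_pow, Nat.factorial_succ]
      push_cast
      rw [zero_pow (Nat.succ_ne_zero n), sub_zero, pow_succ lam]
      field_simp
  intro z hz
  have hlim : Filter.Tendsto (fun n : ℕ => C * ((lam * z) ^ n / n.factorial)) Filter.atTop
      (nhds (C * 0)) := (FloorSemiring.tendsto_pow_div_factorial_atTop _).const_mul C
  rw [mul_zero] at hlim
  exact abs_nonpos_iff.1 (ge_of_tendsto' hlim fun n => key n z hz)

/-- Uniqueness for the renewal equation on `(0, 1]`. -/
lemma eq_renewal_of_volterra (hlam : 0 < lam) {f : ℝ → ℝ} (hf : Measurable f) {α C : ℝ}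
    (hC : ∀ y ∈ Ioc (0 : ℝ) 1, |f y| ≤ C)
    (heq : ∀ z ∈ Ioc (0 : ℝ) 1,
      f z = lam * (α * tail G z + ∫ y in (0 : ℝ)..z, tail G (z - y) * f y)) :
    ∀ z ∈ Ioc (0 : ℝ) 1, f z = α * renewal lam G z := by
  have hr : ∀ y ∈ Ioc (0 : ℝ) 1, |renewal lam G y| ≤ renewalBound lam 1 := fun y hy => by
    rw [abs_of_nonneg (renewal_nonneg hlam hy.1.le)]
    exact renewal_le hlam hy.1.le hy.2
  have h := eq_zero_of_volterra (G := G) hlam (d := fun z => f z - α * renewal lam G z)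
    (b := 1) (C := C + |α| * renewalBound lam 1) (fun y hy => ?_) (fun z hz => ?_)
  · exact fun z hz => sub_eq_zero.1 (h z hz)
  · refine (abs_sub _ _).trans ?_
    rw [abs_mul]
    exact add_le_add (hC y hy) (mul_le_mul_of_nonneg_left (hr y hy) (abs_nonneg _))
  · have hsub : ∀ y ∈ Ioc 0 z, y ∈ Ioc (0 : ℝ) 1 := fun y hy => ⟨hy.1, hy.2.trans hz.2⟩
    have h1 := intervalIntegrable_tail_mul (G := G) hf hz.1.le (fun y hy => hC y (hsub y hy)) z
    have h2 := intervalIntegrable_tail_mul (G := G) (g := renewal lam G) measurable_renewal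
      hz.1.le (fun y hy => hr y (hsub y hy)) z
    have h3 : ∀ y, tail G (z - y) * (f y - α * renewal lam G y) =
        tail G (z - y) * f y - α * (tail G (z - y) * renewal lam G y) := fun y => by ring
    simp_rw [h3]
    rw [intervalIntegral.integral_sub h1 (h2.const_mul α), intervalIntegral.integral_const_mul]
    change f z - α * renewal lam G z = _
    rw [heq z hz, renewal_eq hlam hz.1.le]
    ring

lemma normalizer_eq (hlam : 0 < lam) :
    normalizer lam G =
      1 + lam * (∫ s, s ∂G) * (1 + ∫ y in (0 : ℝ)..1, renewal lam G y) := by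
  rw [normalizer, (hasSum_integral_tailConv hlam zero_le_one).tsum_eq]

/-- The renewal equation brings the case `z ≤ 1` to the same form as the case `z > 1`, which is the
form that the level crossing identity produces. -/
lemma invariantDensity_eq (hlam : 0 < lam) {z : ℝ} (hz : 0 < z) :
    invariantDensity lam G z = lam * (tail G z +
      ∫ y in (0 : ℝ)..min z 1, tail G (z - y) * renewal lam G y) / normalizer lam G := by
  rw [invariantDensity]
  split_ifs with h
  · rw [min_eq_left h, ← renewal_eq hlam hz.le, renewal]
  · rw [min_eq_right (not_le.1 h).le, mul_add,
      (hasSum_integral_tail_renewal hlam z zero_le_one).tsum_eq]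

lemma integral_renewal_nonneg (hlam : 0 < lam) : 0 ≤ ∫ y in (0 : ℝ)..1, renewal lam G y :=
  intervalIntegral.integral_nonneg zero_le_one fun _ hy => renewal_nonneg hlam hy.1

lemma normalizer_pos (hlam : 0 < lam) (hG : G (Iio 0) = 0) : 0 < normalizer lam G := by
  rw [normalizer_eq hlam]
  have h1 := integral_id_nonneg hG
  have h2 := integral_renewal_nonneg (G := G) hlam
  positivity

end Renewal

/-! ### Measures with an atom at 0 and a density -/

section Mixture

/-- The measure with an atom of mass `a` at `0` and density `c` on `(0, ∞)`. -/
noncomputable def atomDensity (a : ℝ≥0∞) (c : ℝ → ℝ≥0∞) : Measure ℝ :=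
  a • Measure.dirac 0 + (volume.restrict (Ioi 0)).withDensity c

variable {lam : ℝ} {G : Measure ℝ} {a : ℝ≥0∞} {c : ℝ → ℝ≥0∞}

lemma lintegral_atomDensity (hc : Measurable c) {f : ℝ → ℝ≥0∞} (hf : Measurable f) :
    ∫⁻ x, f x ∂(atomDensity a c) = a * f 0 + ∫⁻ x in Ioi 0, f x * c x := by
  rw [atomDensity, lintegral_add_measure, lintegral_smul_measure, lintegral_dirac,
    lintegral_withDensity_eq_lintegral_mul _ hc hf, smul_eq_mul]
  congr 1
  exact lintegral_congr fun x => mul_comm _ _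

lemma setLIntegral_Iio_atomDensity (hc : Measurable c) {f : ℝ → ℝ≥0∞} (hf : Measurable f) {z : ℝ}
    (hz : 0 ≤ z) :
    ∫⁻ x in Iio 1, (Iic z).indicator f x ∂(atomDensity a c) =
      a * f 0 + ∫⁻ x in Ioc 0 (min z 1), f x * c x := by
  rw [← lintegral_indicator measurableSet_Iio, lintegral_atomDensity hc
    ((hf.indicator measurableSet_Iic).indicator measurableSet_Iio),
    indicator_of_mem (show (0 : ℝ) ∈ Iio 1 from mem_Iio.2 one_pos), indicator_of_mem (mem_Iic.2 hz),
    ← lintegral_indicator measurableSet_Ioi, ← lintegral_indicator measurableSet_Ioc]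
  congr 1
  refine lintegral_congr_ae ?_
  filter_upwards [measure_eq_zero_iff_ae_notMem.1 (Real.volume_singleton (a := 1))] with x hx
  have hx1 : x ≠ 1 := hx
  have h3 : x ≤ 1 ↔ x < 1 := ⟨fun h => lt_of_le_of_ne h hx1, le_of_lt⟩
  by_cases h1 : x ≤ z <;> by_cases h2 : x < 1 <;> simp [Set.indicator, h1, h2, h3]

/-- Because of the rejection rule, only the atom and the values of `c` on `(0, 1]` enter, at every
level `z`. -/
lemma upcrossing_atomDensity (hc : Measurable c) {z : ℝ} (hz : 0 ≤ z) :
    upcrossing G (atomDensity a c) z =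
      a * G (Ioi z) + ∫⁻ x in Ioc 0 (min z 1), G (Ioi (z - x)) * c x := by
  have := setLIntegral_Iio_atomDensity (a := a) hc
    (f := fun x => G (Ioi (z - x)))
    ((measurable_tail_measure G).comp (measurable_const.sub measurable_id)) hz
  rwa [sub_zero] at this

lemma atomDensity_Iio_one (hc : Measurable c) :
    atomDensity a c (Iio 1) = a + ∫⁻ x in Ioc 0 1, c x := by
  have := setLIntegral_Iio_atomDensity (a := a) hc (f := 1) measurable_one zero_le_one
  simp only [Pi.one_apply, mul_one, one_mul, min_self] at this
  rw [← this, ← lintegral_indicator measurableSet_Iio, ← lintegral_indicator_one measurableSet_Iio]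
  refine lintegral_congr fun x => ?_
  by_cases hx : x < 1
  · simp [Set.indicator, hx, hx.le]
  · simp [Set.indicator, hx]

lemma eq_atomDensity {π : Measure ℝ} (hπ : π (Iio 0) = 0)
    (hc : π.restrict (Ioi 0) = (volume.restrict (Ioi 0)).withDensity c) :
    π = atomDensity (π {0}) c := by
  have h1 : π.restrict (Iic 0) = π.restrict {0} := by
    refine Measure.restrict_congr_set (Filter.eventuallyEq_set.2 ?_)
    filter_upwards [measure_eq_zero_iff_ae_notMem.1 hπ] with x hx
    have hx : 0 ≤ x := not_lt.1 hx
    exact ⟨fun h => le_antisymm h hx, fun h => le_of_eq h⟩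
  rw [atomDensity, ← hc, ← Measure.restrict_singleton, ← h1, ← compl_Iic,
    Measure.restrict_add_restrict_compl measurableSet_Iic]

lemma setLIntegral_ofReal_eq {f : ℝ → ℝ} {b : ℝ} (hb : 0 ≤ b)
    (hf : IntervalIntegrable f volume 0 b) (hnn : ∀ x ∈ Ioc 0 b, 0 ≤ f x) :
    ∫⁻ x in Ioc 0 b, ENNReal.ofReal (f x) = ENNReal.ofReal (∫ x in (0 : ℝ)..b, f x) := by
  rw [intervalIntegral.integral_of_le hb, ofReal_integral_eq_lintegral_ofReal
    ((intervalIntegrable_iff_integrableOn_Ioc_of_le hb).1 hf)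
    ((ae_restrict_iff' measurableSet_Ioc).2 (.of_forall hnn))]

/-- The total rate of upcrossings: every admitted customer lifts the workload by the service
requirement. -/
lemma lintegral_upcrossing {π : Measure ℝ} [SFinite π] [SFinite G] (hG : G (Iio 0) = 0)
    (hmean : Integrable (fun s : ℝ => s) G) (hπ : π (Iio 0) = 0) :
    ∫⁻ z in Ioi 0, upcrossing G π z = ENNReal.ofReal (∫ s, s ∂G) * π (Iio 1) := by
  have hnn : 0 ≤ᵐ[G] fun s : ℝ => s := by
    filter_upwards [measure_eq_zero_iff_ae_notMem.1 hG] with s hs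
    exact not_lt.1 hs
  have hE : ENNReal.ofReal (∫ s, s ∂G) = ∫⁻ u in Ioi 0, G (Ioi u) := by
    rw [ofReal_integral_eq_lintegral_ofReal hmean hnn,
      lintegral_eq_lintegral_meas_lt G hnn aemeasurable_id]
    rfl
  have hm := measurable_upcrossing_integrand G
  unfold upcrossing
  rw [lintegral_lintegral_swap hm.aemeasurable]
  -- After the shift `z = u + x`, each starting point `x ≥ 0` contributes the full integral of the
  -- tail, which is the mean service requirement.
  have hinner : ∀ᵐ x ∂(π.restrict (Iio 1)),
      ∫⁻ z in Ioi 0, (Iic z).indicator (fun x => G (Ioi (z - x))) x =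
        ENNReal.ofReal (∫ s, s ∂G) := by
    refine ae_restrict_of_ae ?_
    filter_upwards [measure_eq_zero_iff_ae_notMem.1 hπ] with x hx
    have hx0 : 0 ≤ x := not_lt.1 hx
    rw [hE, setLIntegral_congr (Ioi_ae_eq_Ici (a := (0 : ℝ))),
      setLIntegral_congr (Ioi_ae_eq_Ici (a := (0 : ℝ))), ← lintegral_indicator measurableSet_Ici,
      ← lintegral_indicator measurableSet_Ici, ← lintegral_add_right_eq_self _ x]
    refine lintegral_congr fun u => ?_
    by_cases hu : 0 ≤ u
    · simp [Set.indicator, hu, add_nonneg hu hx0]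
    · simp [Set.indicator, hu]
  rw [lintegral_congr_ae hinner, lintegral_const, Measure.restrict_apply_univ]

variable [IsProbabilityMeasure G]

lemma upcrossing_atomDensity_ofReal (hc : Measurable c) {α C : ℝ} (hα : 0 ≤ α) {f : ℝ → ℝ}
    (hf : Measurable f) (hf0 : ∀ x ∈ Ioc (0 : ℝ) 1, 0 ≤ f x ∧ f x ≤ C)
    (hfc : ∀ x ∈ Ioc (0 : ℝ) 1, c x = ENNReal.ofReal (f x)) {z : ℝ} (hz : 0 ≤ z) :
    upcrossing G (atomDensity (ENNReal.ofReal α) c) z = ENNReal.ofReal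
      (α * tail G z + ∫ x in (0 : ℝ)..min z 1, tail G (z - x) * f x) := by
  have hb : 0 ≤ min z 1 := le_min hz zero_le_one
  have hsub : ∀ x ∈ Ioc 0 (min z 1), x ∈ Ioc (0 : ℝ) 1 := fun x hx =>
    ⟨hx.1, hx.2.trans (min_le_right _ _)⟩
  have hnn : ∀ x ∈ Ioc 0 (min z 1), 0 ≤ tail G (z - x) * f x := fun x hx =>
    mul_nonneg (tail_nonneg _) (hf0 x (hsub x hx)).1
  rw [upcrossing_atomDensity hc hz, ← ofReal_tail, ← ENNReal.ofReal_mul hα,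
    setLIntegral_congr_fun (g := fun x => ENNReal.ofReal (tail G (z - x) * f x))
      measurableSet_Ioc (fun x hx => ?_),
    setLIntegral_ofReal_eq hb (intervalIntegrable_tail_mul hf (C := C) hb (fun y hy => ?_) z) hnn,
    ← ENNReal.ofReal_add (mul_nonneg hα (tail_nonneg _))]
  · rw [intervalIntegral.integral_of_le hb]
    exact setIntegral_nonneg measurableSet_Ioc hnn
  · rw [abs_of_nonneg (hf0 y (hsub y hy)).1]
    exact (hf0 y (hsub y hy)).2
  · change G (Ioi (z - x)) * c x = ENNReal.ofReal (tail G (z - x) * f x)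
    rw [hfc x (hsub x hx), ENNReal.ofReal_mul (tail_nonneg _), ofReal_tail]

end Mixture

/-! ### Solving the level crossing identity -/

section Solution

variable {lam : ℝ} {G π : Measure ℝ} [IsProbabilityMeasure G]

/-- The level crossing identity determines the density. -/
lemma LevelCrossing.restrict_eq [IsProbabilityMeasure π] (h : LevelCrossing lam G π)
    (hlam : 0 < lam) (hG : G (Iio 0) = 0) (hmean : Integrable (fun s : ℝ => s) G)
    (hπ : π (Iio 0) = 0) :
    π.restrict (Ioi 0) = (volume.restrict (Ioi 0)).withDensity
      fun x => ENNReal.ofReal (invariantDensity lam G x) := by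
  set c : ℝ → ℝ≥0∞ := fun z => ENNReal.ofReal lam * upcrossing G π z with hc
  have hcm : Measurable c := by fun_prop
  have hcle : ∀ z, c z ≤ ENNReal.ofReal lam := fun z =>
    (mul_le_mul_right (upcrossing_le_one z) _).trans_eq (mul_one _)
  have hctop : ∀ z, c z ≠ ∞ := fun z => ne_top_of_le_ne_top ENNReal.ofReal_ne_top (hcle z)
  set f : ℝ → ℝ := fun z => (c z).toReal with hf
  have hfm : Measurable f := hcm.ennreal_toReal
  have hfc : ∀ z, c z = ENNReal.ofReal (f z) := fun z => (ENNReal.ofReal_toReal (hctop z)).symm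
  have hf0 : ∀ z, 0 ≤ f z ∧ f z ≤ lam := fun z =>
    ⟨ENNReal.toReal_nonneg, ENNReal.toReal_le_of_le_ofReal hlam.le (hcle z)⟩
  set α : ℝ := (π {0}).toReal with hα
  have hα0 : 0 ≤ α := ENNReal.toReal_nonneg
  have hπeq : π = atomDensity (ENNReal.ofReal α) c := by
    rw [hα, ENNReal.ofReal_toReal (measure_ne_top _ _)]
    exact eq_atomDensity hπ h
  -- For `z ≤ 1` this is the Volterra equation for `f`; for `z > 1` it expresses `f z` through the
  -- values on `(0, 1]`.
  have hvolt : ∀ z, 0 ≤ z →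
      f z = lam * (α * tail G z + ∫ x in (0 : ℝ)..min z 1, tail G (z - x) * f x) := by
    intro z hz
    have hnn : 0 ≤ ∫ x in (0 : ℝ)..min z 1, tail G (z - x) * f x :=
      intervalIntegral.integral_nonneg (le_min hz zero_le_one) fun x _ =>
        mul_nonneg (tail_nonneg _) (hf0 x).1
    have h1 : c z = ENNReal.ofReal
        (lam * (α * tail G z + ∫ x in (0 : ℝ)..min z 1, tail G (z - x) * f x)) := by
      rw [ENNReal.ofReal_mul hlam.le, ← upcrossing_atomDensity_ofReal hcm hα0 hfm
        (fun x _ => hf0 x) (fun x _ => hfc x) hz, ← hπeq]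
    rw [hf]
    simp only [h1]
    exact ENNReal.toReal_ofReal
      (mul_nonneg hlam.le (add_nonneg (mul_nonneg hα0 (tail_nonneg _)) hnn))
  have hfr : ∀ z ∈ Ioc (0 : ℝ) 1, f z = α * renewal lam G z := by
    refine eq_renewal_of_volterra hlam hfm (C := lam) (fun y _ => ?_) fun z hz => ?_
    · rw [abs_of_nonneg (hf0 y).1]
      exact (hf0 y).2
    · rw [hvolt z hz.1.le, min_eq_left hz.2]
  have hintcongr : ∀ (k : ℝ → ℝ) (b : ℝ), 0 ≤ b → b ≤ 1 →
      ∫ x in (0 : ℝ)..b, k x * f x = α * ∫ x in (0 : ℝ)..b, k x * renewal lam G x := by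
    intro k b hb hb1
    rw [← intervalIntegral.integral_const_mul]
    refine intervalIntegral.integral_congr_ae (.of_forall fun x hx => ?_)
    rw [uIoc_of_le hb] at hx
    rw [hfr x ⟨hx.1, hx.2.trans hb1⟩]
    ring
  -- Total mass fixes the atom: `1 = α + λ E(S) π[0, 1)`, by integrating the level crossing identity
  -- over all levels.
  have hmass : α * normalizer lam G = 1 := by
    have h1 : π univ = π {0} + π (Ioi 0) := by
      conv_lhs => rw [eq_atomDensity hπ h]
      rw [atomDensity, Measure.add_apply, ← h]
      simp
    have h2 : π (Ioi 0) = ENNReal.ofReal (lam * (∫ s, s ∂G) *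
        (α + α * ∫ y in (0 : ℝ)..1, renewal lam G y)) := by
      have hEnn := integral_id_nonneg hG
      have h3 : π (Iio 1) = ENNReal.ofReal (α + α * ∫ y in (0 : ℝ)..1, renewal lam G y) := by
        have h4 := hintcongr (fun _ => 1) 1 zero_le_one le_rfl
        simp only [one_mul] at h4
        rw [hπeq, atomDensity_Iio_one hcm, lintegral_congr hfc,
          setLIntegral_ofReal_eq zero_le_one
            (intervalIntegrable_of_bound hfm (C := lam) zero_le_one fun y _ => by
              rw [abs_of_nonneg (hf0 y).1]; exact (hf0 y).2) (fun x _ => (hf0 x).1),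
          h4, ENNReal.ofReal_add hα0 (mul_nonneg hα0 (integral_renewal_nonneg hlam))]
      have h5 : π (Ioi 0) = ∫⁻ z in Ioi 0, c z := by
        rw [← Measure.restrict_apply_univ, h, withDensity_apply _ MeasurableSet.univ,
          Measure.restrict_univ]
      rw [h5, lintegral_const_mul _ (by fun_prop), lintegral_upcrossing hG hmean hπ, h3,
        ENNReal.ofReal_mul (by positivity), ENNReal.ofReal_mul hlam.le, mul_assoc]
    have hEnn := integral_id_nonneg hG
    have hr := integral_renewal_nonneg (G := G) hlam
    have h6 := congrArg ENNReal.toReal h1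
    rw [measure_univ, ENNReal.toReal_one, ENNReal.toReal_add (measure_ne_top _ _)
      (measure_ne_top _ _), h2, ENNReal.toReal_ofReal (by positivity), ← hα] at h6
    rw [normalizer_eq hlam]
    linear_combination -h6
  have hN := normalizer_pos (G := G) hlam hG
  have hαN : α = 1 / normalizer lam G := by
    rw [eq_div_iff hN.ne', hmass]
  rw [h]
  refine withDensity_congr_ae ((ae_restrict_iff' measurableSet_Ioi).2 (.of_forall fun z hz => ?_))
  have hz0 : (0 : ℝ) < z := hz
  change c z = ENNReal.ofReal (invariantDensity lam G z)
  rw [hfc z, hvolt z hz0.le, invariantDensity_eq hlam hz0,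
    hintcongr _ _ (le_min hz0.le zero_le_one) (min_le_right _ _), hαN]
  congr 1
  ring

/-- There is a probability measure on `[0, ∞)` which satisfies the level crossing identity. -/
lemma exists_levelCrossing (hlam : 0 < lam) (hG : G (Iio 0) = 0)
    (hmean : Integrable (fun s : ℝ => s) G) :
    ∃ π : Measure ℝ, IsProbabilityMeasure π ∧ π (Iio 0) = 0 ∧ LevelCrossing lam G π := by
  have hN := normalizer_pos (G := G) hlam hG
  set α : ℝ := 1 / normalizer lam G with hα
  have hα0 : 0 ≤ α := by positivity
  have hr := integral_renewal_nonneg (G := G) hlam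
  set f : ℝ → ℝ := fun z => α * renewal lam G z with hf
  have hfm : Measurable f := by fun_prop
  have hf0 : ∀ x ∈ Ioc (0 : ℝ) 1, 0 ≤ f x ∧ f x ≤ α * renewalBound lam 1 := fun x hx =>
    ⟨mul_nonneg hα0 (renewal_nonneg hlam hx.1.le),
      mul_le_mul_of_nonneg_left (renewal_le hlam hx.1.le hx.2) hα0⟩
  -- Only the values of `c₀` on `(0, 1]` matter; above 1 it is not the right density.
  set c₀ : ℝ → ℝ≥0∞ := fun x => ENNReal.ofReal (f x)
  have hc₀ : Measurable c₀ := by fun_prop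
  have : SFinite (atomDensity (ENNReal.ofReal α) c₀) := by unfold atomDensity; infer_instance
  -- One application of the upcrossing rate reproduces `c₀` on `(0, 1]`, by the renewal equation,
  -- and supplies the correct values above 1. A second application changes nothing, since upcrossing
  -- rates see only `(0, 1]`; this is the level crossing identity.
  set c : ℝ → ℝ≥0∞ := fun z =>
    ENNReal.ofReal lam * upcrossing G (atomDensity (ENNReal.ofReal α) c₀) z with hc
  have hcm : Measurable c := by fun_prop
  have hcf : ∀ x ∈ Ioc (0 : ℝ) 1, c x = ENNReal.ofReal (f x) := by
    intro x hx
    simp only [hc, upcrossing_atomDensity_ofReal hc₀ hα0 hfm hf0 (fun _ _ => rfl) hx.1.le]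
    rw [← ENNReal.ofReal_mul hlam.le, hf]
    congr 1
    simp only
    rw [renewal_eq hlam hx.1.le, min_eq_left hx.2]
    simp_rw [mul_left_comm _ α]
    rw [intervalIntegral.integral_const_mul]
    ring
  set π : Measure ℝ := atomDensity (ENNReal.ofReal α) c with hπ
  have : SFinite π := by rw [hπ]; unfold atomDensity; infer_instance
  have hneg : π (Iio 0) = 0 := by
    rw [hπ, atomDensity, Measure.add_apply, Measure.smul_apply,
      Measure.dirac_apply' _ measurableSet_Iio,
      withDensity_absolutelyContinuous (volume.restrict (Ioi 0)) c
        (s := Iio 0) (by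
          rw [Measure.restrict_apply measurableSet_Iio, inter_comm, Ioi_inter_Iio, Ioo_self,
            measure_empty])]
    simp
  have hcup : ∀ z, 0 ≤ z → c z = ENNReal.ofReal lam * upcrossing G π z := by
    intro z hz
    rw [hπ, upcrossing_atomDensity_ofReal hcm hα0 hfm hf0 hcf hz,
      ← upcrossing_atomDensity_ofReal hc₀ hα0 hfm hf0 (fun _ _ => rfl) hz]
  have hrestrict : π.restrict (Ioi 0) = (volume.restrict (Ioi 0)).withDensity c := by
    rw [hπ, atomDensity, Measure.restrict_add, Measure.restrict_smul,
      restrict_withDensity measurableSet_Ioi, Measure.restrict_restrict measurableSet_Ioi,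
      inter_self, Measure.restrict_eq_zero.2 (by simp : Measure.dirac (0 : ℝ) (Ioi 0) = 0),
      smul_zero, zero_add]
  have hLC : LevelCrossing lam G π := by
    rw [LevelCrossing, hrestrict]
    exact withDensity_congr_ae ((ae_restrict_iff' measurableSet_Ioi).2
      (.of_forall fun z hz => hcup z (le_of_lt hz)))
  refine ⟨π, ⟨?_⟩, hneg, hLC⟩
  have hEnn := integral_id_nonneg hG
  have h3 : π (Iio 1) = ENNReal.ofReal (α + α * ∫ y in (0 : ℝ)..1, renewal lam G y) := by
    rw [hπ, atomDensity_Iio_one hcm, setLIntegral_congr_fun measurableSet_Ioc hcf,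
      setLIntegral_ofReal_eq zero_le_one
        (intervalIntegrable_of_bound hfm (C := α * renewalBound lam 1) zero_le_one fun y hy => by
          rw [abs_of_nonneg (hf0 y hy).1]; exact (hf0 y hy).2) (fun x hx => (hf0 x hx).1),
      ← intervalIntegral.integral_const_mul, ENNReal.ofReal_add hα0]
    rw [intervalIntegral.integral_const_mul]
    exact mul_nonneg hα0 hr
  have h4 : ∫⁻ z in Ioi 0, c z = ENNReal.ofReal (lam * (∫ s, s ∂G) *
        (α + α * ∫ y in (0 : ℝ)..1, renewal lam G y)) := by
    rw [setLIntegral_congr_fun measurableSet_Ioi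
      (fun z hz => hcup z (le_of_lt hz)), lintegral_const_mul _ (by fun_prop),
      lintegral_upcrossing hG hmean hneg, h3, ENNReal.ofReal_mul (by positivity),
      ENNReal.ofReal_mul hlam.le, mul_assoc]
  have h5 := lintegral_atomDensity (a := ENNReal.ofReal α) hcm measurable_one
  simp only [Pi.one_apply, lintegral_one, mul_one, one_mul] at h5
  rw [hπ, h5, h4, ← ENNReal.ofReal_add hα0 (by positivity), ← ENNReal.ofReal_one]
  congr 1
  have h6 : α * normalizer lam G = 1 := by rw [hα]; field_simp
  rw [normalizer_eq hlam] at h6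
  linear_combination h6

end Solution

end BoundedWait

open BoundedWait in
theorem theorem4 {Ω : Type*} [MeasurableSpace Ω] (P : Measure Ω) [IsProbabilityMeasure P]
    (lam : ℝ) (hlam : 0 < lam)
    (G : Measure ℝ) [IsProbabilityMeasure G] (hG : G (Iio 0) = 0)
    (I S : ℕ → Ω → ℝ) (hIS : IsMG1Input P lam G I S)
    (hmean : Integrable (fun s : ℝ => s) G) :
    (∃ π : Measure ℝ, IsInvariant P I S π) ∧
    (∀ π : Measure ℝ, IsInvariant P I S π →
      π.restrict (Ioi 0) =
        (volume.restrict (Ioi 0)).withDensity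
          (fun x => ENNReal.ofReal (invariantDensity lam G x))) ∧
    -- all series that enter the formula for the density converge
    (∀ x ∈ Ioc (0 : ℝ) 1, Summable fun i : ℕ => lam ^ (i + 1) * tailConv G i x) ∧
    (Summable fun i : ℕ => lam ^ (i + 1) * ∫ y in (0 : ℝ)..1, tailConv G i y) ∧
    (∀ x ∈ Ioi (1 : ℝ), Summable fun i : ℕ =>
      lam ^ (i + 1) * ∫ y in (0 : ℝ)..1, tail G (x - y) * tailConv G i y) := by
  refine ⟨?_, fun π hπ => ?_, fun x hx => summable_renewal hlam hx.1.le,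
    (hasSum_integral_tailConv hlam zero_le_one).summable,
    fun x _ => (hasSum_integral_tail_renewal hlam x zero_le_one).summable⟩
  · obtain ⟨π, hprob, hneg, hLC⟩ := exists_levelCrossing hlam hG hmean
    exact ⟨π, hIS.isInvariant_of_eq_stepLaw hlam hneg
      ((eq_stepLaw_iff_levelCrossing hlam hG hneg).2 hLC)⟩
  · have := hπ.isProbabilityMeasure
    exact ((eq_stepLaw_iff_levelCrossing hlam hG hπ.nonneg).1
      (hIS.eq_stepLaw_of_isInvariant hlam hπ)).restrict_eq hlam hG hmean hπ.nonneg
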